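/- Let $a,b,c\in\mathbb{R}$ and consider the planar polynomial differential system $$\dot x=-y,\qquad \dot y=x^5+ax^6+y\,(bx^3+cx^4).$$ A singular point $p$ of a planar system is a center if it has a neighborhood $U$ such that all the orbits of $U\setminus\{p\}$ are periodic; a center $p$ is nilpotent if, after an affine change of variables sending $p$ to the origin and a rescaling of the time by a nonzero constant, the system can be written near the origin as $\dot x=y+F_1(x,y)$, $\dot y=F_2(x,y)$, with $F_1,F_2$ real analytic near the origin and without constant and linear terms. Then the system above has a nilpotent center at the origin if and only if $ab=0$ and $c=0$. -/

import Mathlib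

open Filter Topology

namespace PlanarSystem

/-- `γ` is a complete solution of the autonomous planar system `ż = X z`. -/
def IsSolution (X : ℝ × ℝ → ℝ × ℝ) (γ : ℝ → ℝ × ℝ) : Prop :=
  ∀ t : ℝ, HasDerivAt γ (X (γ t)) t

/-- `γ` parametrizes a periodic orbit of `ż = X z`: it is a nonconstant solution, defined for all
times, with some period `T > 0`. -/
def IsPeriodicOrbit (X : ℝ × ℝ → ℝ × ℝ) (γ : ℝ → ℝ × ℝ) : Prop :=
  IsSolution X γ ∧ (∃ t : ℝ, γ t ≠ γ 0) ∧ ∃ T : ℝ, 0 < T ∧ Function.Periodic γ T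

/-- The singular point `p` of `ż = X z` is a center: there is a neighborhood `U` of `p` such that
all the orbits of `U \ {p}` are periodic, that is, through every point of `U \ {p}` there passes a
periodic orbit that lies in `U \ {p}`. -/
def IsCenter (X : ℝ × ℝ → ℝ × ℝ) (p : ℝ × ℝ) : Prop :=
  X p = 0 ∧ ∃ U ∈ 𝓝 p, ∀ q ∈ U \ {p},
    ∃ γ : ℝ → ℝ × ℝ, γ 0 = q ∧ IsPeriodicOrbit X γ ∧ ∀ t : ℝ, γ t ∈ U \ {p}

/-- `F` is a real analytic function near the origin without constant and linear terms. -/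
def IsAnalyticNonlinear (F : ℝ × ℝ → ℝ) : Prop :=
  AnalyticAt ℝ F 0 ∧ F 0 = 0 ∧ fderiv ℝ F 0 = 0

/-- After an affine change of variables `z = e q` sending `p` to the origin and a rescaling
`t = τ s` of the time, the system `dq/dt = X q` is written, near the origin, as
`dx/ds = y + F₁ (x, y)`, `dy/ds = F₂ (x, y)`, where `z = (x, y)` and `F₁`, `F₂` are real analytic
without constant and linear terms. -/
def HasNilpotentForm (X : ℝ × ℝ → ℝ × ℝ) (p : ℝ × ℝ) : Prop :=
  ∃ (e : (ℝ × ℝ) ≃ᵃ[ℝ] (ℝ × ℝ)) (τ : ℝ) (F₁ F₂ : ℝ × ℝ → ℝ),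
    e p = 0 ∧ τ ≠ 0 ∧ IsAnalyticNonlinear F₁ ∧ IsAnalyticNonlinear F₂ ∧
    ∀ᶠ z in 𝓝 (0 : ℝ × ℝ), τ • e.linear (X (e.symm z)) = (z.2 + F₁ z, F₂ z)

/-- `p` is a nilpotent center of the system `ż = X z`. -/
def IsNilpotentCenter (X : ℝ × ℝ → ℝ × ℝ) (p : ℝ × ℝ) : Prop :=
  IsCenter X p ∧ HasNilpotentForm X p

/-- The system `ẋ = -y`, `ẏ = x⁵ + a x⁶ + y (b x³ + c x⁴)`. -/
def quinticSystem (a b c : ℝ) : ℝ × ℝ → ℝ × ℝ := fun z =>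
  (-z.2, z.1 ^ 5 + a * z.1 ^ 6 + z.2 * (b * z.1 ^ 3 + c * z.1 ^ 4))

end PlanarSystem

/-!
In the variables `x` and `w = y + F x`, where `F` is the antiderivative of the friction
`b x³ + c x⁴`, the system takes the Liénard form `ẋ = F x - w`, `ẇ = g x`. Near the origin `F x` is
negligible against the square root of the potential `G x = x⁶ / 6 + a x⁷ / 7`, hence against that of
the energy `w² / 2 + G x`, and every orbit turns around the origin.

In one turn a value of `w` is attained at a point `X > 0` and again at a point `Y < 0`, and along
the turn the difference `G X - G Y` has derivative `g X * (F X - F Y)`. If `F` is a function of `G`,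
this differential equation forces `G X = G Y` throughout, so the orbit closes up. If instead `F`
differs from a function of `G` by a term whose sign is opposite to that of `x`, the derivative is
smaller, and the orbit returns to the negative `w`-axis strictly closer to the origin; the case of a
term with the sign of `x` follows by the reflection `x ↦ -x`, `t ↦ -t`.

For the quintic system put `m³ = 1 + 6 a x / 7`, so that `s = x² m` is the cube root of `6 G`. The
function `S = b s² / 4 + a² b s³ / 49` of `G` has the same terms as `F` in degrees four and six, and
`F - S = x⁵ (c / 5 - a b / 7 - a b R)` with a weight `R ≥ 0` vanishing only at `m = 1`. The bracket
vanishes identically if `a b = 0` and `c = 0`, and otherwise has a constant sign near the origin.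
-/

namespace PlanarSystem

open Set NNReal

section Calculus

variable {f f' : ℝ → ℝ} {K p q : ℝ}

theorem nonpos_of_deriv_le_mul_abs (hc : ContinuousOn f (Icc p q))
    (hf : ∀ t ∈ Ioo p q, HasDerivAt f (f' t) t) (hK : ∀ t ∈ Ioo p q, f' t ≤ K * |f t|)
    (hp : f p ≤ 0) : ∀ t ∈ Icc p q, f t ≤ 0 := by
  intro ξ hξ
  by_contra! hpos
  have hcξ : ContinuousOn f (Icc p ξ) := hc.mono (Icc_subset_Icc le_rfl hξ.2)
  have hS : IsCompact (Icc p ξ ∩ f ⁻¹' Iic 0) :=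
    isCompact_Icc.of_isClosed_subset (hcξ.preimage_isClosed_of_isClosed isClosed_Icc isClosed_Iic)
      inter_subset_left
  obtain ⟨m, ⟨hm, hfm⟩, hmax⟩ := hS.exists_isGreatest ⟨p, ⟨le_rfl, hξ.1⟩, hp⟩
  have hfpos : ∀ t ∈ Ioo m ξ, 0 < f t := fun t ht => by
    by_contra! hle
    exact ht.1.not_ge (hmax ⟨⟨hm.1.trans ht.1.le, ht.2.le⟩, hle⟩)
  have hexp : ∀ t, HasDerivAt (fun t => Real.exp (-K * t)) (Real.exp (-K * t) * -K) t := fun t => by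
    simpa using ((hasDerivAt_id t).const_mul (-K)).exp
  have hanti : AntitoneOn (fun t => f t * Real.exp (-K * t)) (Icc m ξ) := by
    refine antitoneOn_of_hasDerivWithinAt_nonpos (convex_Icc m ξ)
      (f' := fun t => f' t * Real.exp (-K * t) + f t * (Real.exp (-K * t) * -K))
      ((hcξ.mono (Icc_subset_Icc hm.1 le_rfl)).mul (by fun_prop)) ?_ ?_
    all_goals
      rw [interior_Icc]
      intro t ht
      have htpq : t ∈ Ioo p q := ⟨hm.1.trans_lt ht.1, ht.2.trans_le hξ.2⟩
    · exact ((hf t htpq).mul (hexp t)).hasDerivWithinAt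
    · have hle := hK t htpq
      rw [abs_of_pos (hfpos t ht)] at hle
      nlinarith [Real.exp_pos (-K * t)]
  have hlt : 0 < f ξ * Real.exp (-K * ξ) := mul_pos hpos (Real.exp_pos _)
  have hle : f m * Real.exp (-K * m) ≤ 0 := mul_nonpos_of_nonpos_of_nonneg hfm (Real.exp_pos _).le
  linarith [hanti (left_mem_Icc.2 hm.2) (right_mem_Icc.2 hm.2) hm.2]

theorem eq_zero_of_deriv_le_mul_abs (hc : ContinuousOn f (Icc p q))
    (hf : ∀ t ∈ Ioo p q, HasDerivAt f (f' t) t) (hK : ∀ t ∈ Ioo p q, f' t ≤ K * |f t|)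
    (hp : f p ≤ 0) (hq : 0 ≤ f q) : ∀ t ∈ Icc p q, f t = 0 := by
  have hrev : ∀ t ∈ Icc p q, p + q - t ∈ Icc p q := fun t ht =>
    ⟨by linarith [ht.2], by linarith [ht.1]⟩
  have hrev' : ∀ t ∈ Ioo p q, p + q - t ∈ Ioo p q := fun t ht =>
    ⟨by linarith [ht.2], by linarith [ht.1]⟩
  have hreflect : ∀ t ∈ Icc p q, -f (p + q - t) ≤ 0 :=
    nonpos_of_deriv_le_mul_abs (f' := fun t => f' (p + q - t)) (K := K)
      (hc.comp (by fun_prop) hrev).neg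
      (fun t ht => ((hf _ (hrev' t ht)).comp_const_sub (p + q) t).neg.congr_deriv (neg_neg _))
      (fun t ht => by simpa using hK _ (hrev' t ht)) (by simpa using hq)
  intro t ht
  refine le_antisymm (nonpos_of_deriv_le_mul_abs hc hf hK hp t ht) ?_
  simpa using hreflect _ (hrev t ht)

theorem eventually_lt_nhdsGT_of_hasDerivAt_pos {d t₀ : ℝ} (hf : HasDerivAt f d t₀) (hd : 0 < d) :
    ∀ᶠ t in 𝓝[>] t₀, f t₀ < f t := by
  have hslope := (hasDerivAt_iff_tendsto_slope.1 hf).mono_left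
    (nhdsWithin_mono t₀ fun t (ht : t ∈ Ioi t₀) => ht.ne')
  filter_upwards [hslope.eventually (lt_mem_nhds hd), self_mem_nhdsWithin] with t ht hlt
  exact (slope_pos_iff_of_le (le_of_lt hlt)).1 ht

theorem deriv_nonpos_of_pos_left {d t₀ t₁ : ℝ} (hf : HasDerivAt f d t₁) (ht : t₀ < t₁)
    (hzero : f t₁ = 0) (hpos : ∀ t ∈ Ioo t₀ t₁, 0 < f t) : d ≤ 0 := by
  have hslope := (hasDerivAt_iff_tendsto_slope.1 hf).mono_left
    (nhdsWithin_mono t₁ fun t (ht : t ∈ Iio t₁) => ht.ne)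
  refine le_of_tendsto hslope ?_
  filter_upwards [Ioo_mem_nhdsLT ht] with t htt
  rw [slope_def_field, hzero]
  exact div_nonpos_of_nonneg_of_nonpos (by linarith [hpos t htt]) (by linarith [htt.2])

theorem hasDerivAt_of_comp {τ : ℝ → ℝ} {t d e : ℝ} (hτ : ContinuousAt τ t)
    (hf : HasDerivAt f d (τ t)) (hd : d ≠ 0) (hcomp : HasDerivAt (f ∘ τ) e t) :
    HasDerivAt τ (e / d) t := by
  have hds : Tendsto (fun s => dslope f (τ t) (τ s)) (𝓝 t) (𝓝 d) := by
    have := (continuousAt_dslope_same.2 hf.differentiableAt).tendsto.comp hτ.tendsto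
    rwa [dslope_same, hf.deriv] at this
  rw [hasDerivAt_iff_tendsto_slope] at hcomp ⊢
  refine (hcomp.div (hds.mono_left nhdsWithin_le_nhds) hd).congr' ?_
  filter_upwards [nhdsWithin_le_nhds (hds.eventually_ne hd)] with s hs
  have hmul : (τ s - τ t) * dslope f (τ t) (τ s) = f (τ s) - f (τ t) :=
    sub_smul_dslope f (τ t) (τ s)
  rw [Pi.div_apply, div_eq_iff hs, slope_def_field, slope_def_field, div_mul_eq_mul_div, hmul,
    Function.comp_apply, Function.comp_apply]

theorem exists_first_exit {S : Set ℝ} {t₀ t : ℝ} (hS : IsOpen S) (hev : ∀ᶠ s in 𝓝[>] t₀, s ∈ S)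
    (ht : t₀ < t) (htS : t ∉ S) : ∃ t₁ > t₀, Ioo t₀ t₁ ⊆ S ∧ t₁ ∉ S := by
  obtain ⟨u, hu, hsub⟩ := mem_nhdsGT_iff_exists_Ioo_subset.1 hev
  have hle : ∀ s > t₀, s ∉ S → u ≤ s := fun s hs hsS => by
    by_contra! hlt
    exact hsS (hsub ⟨hs, hlt⟩)
  have hbdd : BddBelow (Ici u ∩ Sᶜ) := ⟨u, fun s hs => hs.1⟩
  obtain ⟨hmem, hnot⟩ := (isClosed_Ici.inter hS.isClosed_compl).csInf_mem
    ⟨t, hle t ht htS, htS⟩ hbdd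
  refine ⟨_, lt_of_lt_of_le hu hmem, fun s hs => ?_, hnot⟩
  by_contra hsS
  exact hs.2.not_ge (csInf_le hbdd ⟨hle s hs.1 hsS, hsS⟩)

theorem exists_continuousOn_rightInverse {s : Set ℝ} [OrdConnected s] (hm : StrictMonoOn f s)
    (hc : ContinuousOn f s) :
    ∃ v : ℝ → ℝ, ContinuousOn v (f '' s) ∧ ∀ y ∈ f '' s, v y ∈ s ∧ f (v y) = y := by
  have : OrdConnected (f '' s) :=
    ((isPreconnected_iff_ordConnected.2 ‹_›).image f hc).ordConnected
  refine ⟨Function.invFunOn f s, ?_, fun y hy =>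
    ⟨Function.invFunOn_mem hy, Function.invFunOn_eq hy⟩⟩
  rw [continuousOn_iff_continuous_domRestrict]
  refine (continuous_subtype_val.comp (hm.orderIso f s).symm.continuous).congr fun y => ?_
  obtain ⟨x, rfl⟩ := (hm.orderIso f s).surjective y
  have hx : (hm.orderIso f s x : ℝ) = f x := rfl
  simpa [hx] using (hm.injOn.leftInvOn_invFunOn x.2).symm

theorem exists_continuousOn_conjugate {t₀ t₁ t₂ : ℝ} (h₀₁ : t₀ < t₁) (h₁₂ : t₁ < t₂)
    (hc : ContinuousOn f (Icc t₀ t₂)) (hmono : StrictMonoOn f (Icc t₀ t₁))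
    (hanti : StrictAntiOn f (Icc t₁ t₂)) (hle : f t₂ ≤ f t₀) :
    ∃ τ : ℝ → ℝ, ContinuousOn τ (Icc t₀ t₁) ∧
      (∀ t ∈ Icc t₀ t₁, τ t ∈ Icc t₁ t₂ ∧ f (τ t) = f t) ∧ ∀ t ∈ Ioo t₀ t₁, τ t ∈ Ioo t₁ t₂ := by
  have hc₁₂ := hc.mono (Icc_subset_Icc_left h₀₁.le)
  obtain ⟨v, hvc, hv⟩ := exists_continuousOn_rightInverse hanti.neg hc₁₂.neg
  have hmaps : MapsTo (fun t => -f t) (Icc t₀ t₁) ((-f) '' Icc t₁ t₂) := fun t ht => by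
    refine intermediate_value_Icc h₁₂.le hc₁₂.neg ⟨neg_le_neg ?_, neg_le_neg ?_⟩
    · exact hmono.monotoneOn ht (right_mem_Icc.2 h₀₁.le) ht.2
    · exact hle.trans (hmono.monotoneOn (left_mem_Icc.2 h₀₁.le) ht ht.1)
  have hτ : ∀ t ∈ Icc t₀ t₁, v (-f t) ∈ Icc t₁ t₂ ∧ f (v (-f t)) = f t := fun t ht =>
    ⟨(hv _ (hmaps ht)).1, neg_injective (hv _ (hmaps ht)).2⟩
  refine ⟨fun t => v (-f t), hvc.comp (hc.mono (Icc_subset_Icc_right h₁₂.le)).neg hmaps, hτ,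
    fun t ht => ?_⟩
  have htI := Ioo_subset_Icc_self ht
  obtain ⟨⟨hl, hr⟩, heq⟩ := hτ t htI
  refine ⟨hl.lt_of_ne fun h => ?_, hr.lt_of_ne fun h => ?_⟩
  · rw [← h] at heq
    exact (hmono htI (right_mem_Icc.2 h₀₁.le) ht.2).ne heq.symm
  · rw [h] at heq
    exact (hle.trans_lt (hmono (left_mem_Icc.2 h₀₁.le) htI ht.1)).ne heq

end Calculus

section CompleteFlow

variable {E : Type*} [NormedAddCommGroup E] [NormedSpace ℝ E] [CompleteSpace E] {V : E → E}
  {K : ℝ≥0}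

theorem exists_local_solution_of_lipschitzWith (hV : LipschitzWith K V) (x : E) :
    ∃ γ : ℝ → E, γ 0 = x ∧
      ∀ t ∈ Ioo (-(1 / (K + 1 : ℝ))) (1 / (K + 1)), HasDerivAt γ (V (γ t)) t := by
  set ε : ℝ := 1 / (K + 1) with hε
  have hε₀ : 0 ≤ ε := by positivity
  have hnorm : ∀ z ∈ Metric.closedBall x ‖V x‖₊, ‖V z‖ ≤ (‖V x‖₊ + K * ‖V x‖₊ : ℝ≥0) := by
    intro z hz
    rw [mem_closedBall_iff_norm] at hz
    have hlip := hV.norm_sub_le z x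
    push_cast at hz ⊢
    have htri := norm_le_norm_add_norm_sub' (V z) (V x)
    have := mul_le_mul_of_nonneg_left hz K.coe_nonneg
    linarith
  have hp : IsPicardLindelof (fun _ => V) (⟨0, by simpa using hε₀⟩ : Icc (-ε) ε) x
      ‖V x‖₊ 0 (‖V x‖₊ + K * ‖V x‖₊) K :=
    .of_time_independent hnorm hV.lipschitzOnWith (by
      have hK : (K + 1 : ℝ) ≠ 0 := by positivity
      refine le_of_eq ?_
      simp only [sub_zero, zero_sub, neg_neg, max_self, hε]
      push_cast
      field_simp
      ring)
  obtain ⟨γ, h₀, hγ⟩ := hp.exists_eq_forall_mem_Icc_hasDerivWithinAt₀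
  exact ⟨γ, h₀, fun t ht =>
    (hγ t (Ioo_subset_Icc_self ht)).hasDerivAt (Icc_mem_nhds ht.1 ht.2)⟩

theorem exists_complete_solution_of_lipschitzWith (hV : LipschitzWith K V) (hV₁ : ContDiff ℝ 1 V)
    (x : E) : ∃ γ : ℝ → E, γ 0 = x ∧ ∀ t, HasDerivAt γ (V (γ t)) t := by
  obtain ⟨γ, h₀, hγ⟩ := exists_isMIntegralCurve_of_isMIntegralCurveOn
    (I := modelWithCornersSelf ℝ E) (M := E) (v := V) (ε := 1 / (K + 1))
    (contMDiff_vectorSpace_iff_contDiff.2 hV₁) (by positivity) (fun y => by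
      obtain ⟨γ, h₀, hγ⟩ := exists_local_solution_of_lipschitzWith hV y
      exact ⟨γ, h₀, fun t ht => (hγ t ht).hasFDerivAt.hasMFDerivAt.hasMFDerivWithinAt⟩) x
  exact ⟨γ, h₀, fun t => hasDerivAt_iff_hasFDerivAt.2 (hasMFDerivAt_iff_hasFDerivAt.1 (hγ t))⟩

end CompleteFlow

/-! ### The Liénard plane -/

/-- The hypotheses under which the origin of `ẋ = F x - w`, `ẇ = g x` is monodromic, on the strip
`|x| ≤ η`: `G` is the potential of the restoring force `g`, and the damping `F` is dominated by the
square root of `G`. The constant `2 / 9` makes `3 * |F x|` at most `√(w ^ 2 + 2 * G x)`, and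
`G x ≤ x * g x` replaces the monotonicity of `g`. -/
structure IsMonodromicOn (F g G : ℝ → ℝ) (η : ℝ) : Prop where
  pos : 0 < η
  potential_zero : G 0 = 0
  hasDerivAt_potential : ∀ x, |x| ≤ η → HasDerivAt G (g x) x
  mul_force_pos : ∀ x, |x| ≤ η → x ≠ 0 → 0 < x * g x
  potential_le : ∀ x, |x| ≤ η → G x ≤ x * g x
  damping_sq_le : ∀ x, |x| ≤ η → F x ^ 2 ≤ 2 / 9 * G x

/-- The square root of twice the energy `w ^ 2 / 2 + G x`, a substitute for the distance to the
origin in the Liénard plane. -/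
noncomputable def energyRadius (G : ℝ → ℝ) (x w : ℝ) : ℝ := √(w ^ 2 + 2 * G x)

/-- The largest radius whose sublevel set of `energyRadius` stays in the strip `|x| < η`. -/
noncomputable def escapeRadius (G : ℝ → ℝ) (η : ℝ) : ℝ :=
  min (energyRadius G η 0) (energyRadius G (-η) 0)

namespace IsMonodromicOn

variable {F g G : ℝ → ℝ} {η x w : ℝ}

theorem reflect (h : IsMonodromicOn F g G η) :
    IsMonodromicOn (fun x => F (-x)) (fun x => -g (-x)) (fun x => G (-x)) η where
  pos := h.pos
  potential_zero := by simpa using h.potential_zero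
  hasDerivAt_potential x hx :=
    ((h.hasDerivAt_potential (-x) (by rwa [abs_neg])).scomp x (hasDerivAt_neg x)).congr_deriv
      (by simp)
  mul_force_pos x hx hx₀ := by
    simpa using h.mul_force_pos (-x) (by rwa [abs_neg]) (neg_ne_zero.2 hx₀)
  potential_le x hx := by simpa using h.potential_le (-x) (by rwa [abs_neg])
  damping_sq_le x hx := h.damping_sq_le (-x) (by rwa [abs_neg])

theorem neg_damping (h : IsMonodromicOn F g G η) : IsMonodromicOn (fun x => -F x) g G η where
  __ := h
  damping_sq_le x hx := by simpa using h.damping_sq_le x hx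

theorem potential_nonneg (h : IsMonodromicOn F g G η) (hx : |x| ≤ η) : 0 ≤ G x := by
  linarith [h.damping_sq_le x hx, sq_nonneg (F x)]

theorem damping_zero (h : IsMonodromicOn F g G η) : F 0 = 0 := by
  have hsq := h.damping_sq_le 0 (by simpa using h.pos.le)
  rw [h.potential_zero, mul_zero] at hsq
  exact pow_eq_zero_iff two_ne_zero |>.1 (le_antisymm hsq (sq_nonneg _))

theorem force_zero (h : IsMonodromicOn F g G η) : g 0 = 0 := by
  have hmin : IsLocalMin G 0 := by
    filter_upwards [Icc_mem_nhds (neg_lt_zero.2 h.pos) h.pos] with x hx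
    rw [h.potential_zero]
    exact h.potential_nonneg (abs_le.2 hx)
  exact hmin.hasDerivAt_eq_zero (h.hasDerivAt_potential 0 (by simpa using h.pos.le))

theorem force_pos (h : IsMonodromicOn F g G η) (hx : 0 < x) (hxη : x ≤ η) : 0 < g x :=
  pos_of_mul_pos_right (h.mul_force_pos x (abs_le.2 ⟨by linarith, hxη⟩) hx.ne') hx.le

theorem force_neg (h : IsMonodromicOn F g G η) (hx : x < 0) (hxη : -η ≤ x) : g x < 0 :=
  neg_of_mul_pos_right (h.mul_force_pos x (abs_le.2 ⟨hxη, by linarith⟩) hx.ne) hx.le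

theorem potential_pos_of_pos (h : IsMonodromicOn F g G η) (hx : 0 < x) (hxη : x ≤ η) :
    0 < G x := by
  have hbox : ∀ y ∈ Icc 0 η, |y| ≤ η := fun y hy => abs_le.2 ⟨by linarith [hy.1, h.pos], hy.2⟩
  have hmono : StrictMonoOn G (Icc 0 η) := by
    refine strictMonoOn_of_deriv_pos (convex_Icc 0 η) (fun y hy =>
      (h.hasDerivAt_potential y (hbox y hy)).continuousAt.continuousWithinAt) fun y hy => ?_
    rw [interior_Icc] at hy
    rw [(h.hasDerivAt_potential y (hbox y (Ioo_subset_Icc_self hy))).deriv]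
    exact h.force_pos hy.1 hy.2.le
  simpa [h.potential_zero] using hmono (left_mem_Icc.2 h.pos.le) ⟨hx.le, hxη⟩ hx

theorem potential_pos (h : IsMonodromicOn F g G η) (hx : |x| ≤ η) (hx₀ : x ≠ 0) : 0 < G x := by
  rcases hx₀.lt_or_gt with hneg | hpos
  · simpa using h.reflect.potential_pos_of_pos (neg_pos.2 hneg) (neg_le.1 (abs_le.1 hx).1)
  · exact h.potential_pos_of_pos hpos (abs_le.1 hx).2

theorem energyRadius_sq (h : IsMonodromicOn F g G η) (hx : |x| ≤ η) (w : ℝ) :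
    energyRadius G x w ^ 2 = w ^ 2 + 2 * G x :=
  Real.sq_sqrt (by linarith [h.potential_nonneg hx, sq_nonneg w])

theorem abs_le_energyRadius (h : IsMonodromicOn F g G η) (hx : |x| ≤ η) (w : ℝ) :
    |w| ≤ energyRadius G x w :=
  Real.abs_le_sqrt (by linarith [h.potential_nonneg hx])

theorem three_mul_abs_damping_le (h : IsMonodromicOn F g G η) (hx : |x| ≤ η) (w : ℝ) :
    3 * |F x| ≤ energyRadius G x w := by
  rw [← abs_of_pos (three_pos (α := ℝ)), ← abs_mul]
  exact Real.abs_le_sqrt (by linarith [h.damping_sq_le x hx, sq_nonneg w])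

theorem energyRadius_pos (h : IsMonodromicOn F g G η) (hx : |x| ≤ η) (hxw : x ≠ 0 ∨ w ≠ 0) :
    0 < energyRadius G x w := by
  refine Real.sqrt_pos.2 ?_
  rcases hxw with hx₀ | hw
  · linarith [h.potential_pos hx hx₀, sq_nonneg w]
  · linarith [h.potential_nonneg hx, sq_pos_of_ne_zero hw]

theorem energyRadius_zero_left (h : IsMonodromicOn F g G η) (w : ℝ) :
    energyRadius G 0 w = |w| := by
  simp [energyRadius, h.potential_zero, Real.sqrt_sq_eq_abs]

theorem escapeRadius_pos (h : IsMonodromicOn F g G η) : 0 < escapeRadius G η :=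
  lt_min (h.energyRadius_pos (abs_of_pos h.pos).le (.inl h.pos.ne'))
    (h.energyRadius_pos (by rw [abs_neg, abs_of_pos h.pos]) (.inl (neg_ne_zero.2 h.pos.ne')))

theorem abs_lt_of_energyRadius_lt (hx : |x| ≤ η) (hr : energyRadius G x w < escapeRadius G η) :
    |x| < η := by
  refine lt_of_le_of_ne hx fun heq => hr.not_ge ?_
  have hle : energyRadius G x 0 ≤ energyRadius G x w :=
    Real.sqrt_le_sqrt (by linarith [sq_nonneg w])
  rcases eq_or_eq_neg_of_abs_eq heq with rfl | rfl
  · exact (min_le_left _ _).trans hle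
  · exact (min_le_right _ _).trans hle

end IsMonodromicOn

theorem escapeRadius_neg (G : ℝ → ℝ) (η : ℝ) :
    escapeRadius (fun x => G (-x)) η = escapeRadius G η := by
  simp only [escapeRadius, energyRadius, neg_neg]
  exact min_comm _ _

/-- `x` and `w` solve the Liénard equations `ẋ = F x - w`, `ẇ = g x` as long as `|x| ≤ η`. -/
structure IsLienardCurveOn (F g : ℝ → ℝ) (η : ℝ) (x w : ℝ → ℝ) : Prop where
  continuous_fst : Continuous x
  continuous_snd : Continuous w
  hasDerivAt_fst : ∀ t, |x t| ≤ η → HasDerivAt x (F (x t) - w t) t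
  hasDerivAt_snd : ∀ t, |x t| ≤ η → HasDerivAt w (g (x t)) t

namespace IsLienardCurveOn

variable {F g G x w : ℝ → ℝ} {η t t₀ t₁ : ℝ}

theorem halfTurn (h : IsLienardCurveOn F g η x w) :
    IsLienardCurveOn (fun x => -F (-x)) (fun x => -g (-x)) η (fun t => -x t) (fun t => -w t) where
  continuous_fst := h.continuous_fst.neg
  continuous_snd := h.continuous_snd.neg
  hasDerivAt_fst t ht :=
    (h.hasDerivAt_fst t (by rwa [abs_neg] at ht)).neg.congr_deriv (by rw [neg_neg]; ring)
  hasDerivAt_snd t ht :=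
    (h.hasDerivAt_snd t (by rwa [abs_neg] at ht)).neg.congr_deriv (by rw [neg_neg])

theorem reflect (h : IsLienardCurveOn F g η x w) :
    IsLienardCurveOn (fun x => F (-x)) (fun x => -g (-x)) η (fun t => -x (-t))
      (fun t => w (-t)) where
  continuous_fst := (h.continuous_fst.comp continuous_neg).neg
  continuous_snd := h.continuous_snd.comp continuous_neg
  hasDerivAt_fst t ht :=
    ((h.hasDerivAt_fst (-t) (by rwa [abs_neg] at ht)).scomp t (hasDerivAt_neg t)).neg.congr_deriv
      (by simp)
  hasDerivAt_snd t ht :=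
    ((h.hasDerivAt_snd (-t) (by rwa [abs_neg] at ht)).scomp t (hasDerivAt_neg t)).congr_deriv
      (by simp)

theorem continuousOn_energyRadius (h : IsLienardCurveOn F g η x w) (hη : IsMonodromicOn F g G η)
    {s : Set ℝ} (hbox : ∀ t ∈ s, |x t| ≤ η) :
    ContinuousOn (fun t => energyRadius G (x t) (w t)) s := by
  have hG : ContinuousOn (fun t => G (x t)) s := fun t ht =>
    (((hη.hasDerivAt_potential _ (hbox t ht)).comp t
      (h.hasDerivAt_fst t (hbox t ht))).continuousAt).continuousWithinAt
  exact ((h.continuous_snd.continuousOn.pow 2).add (hG.const_mul 2)).sqrt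

theorem hasDerivAt_energyRadius (h : IsLienardCurveOn F g η x w) (hη : IsMonodromicOn F g G η)
    (hbox : |x t| ≤ η) (hx₀ : x t ≠ 0) :
    HasDerivAt (fun t => energyRadius G (x t) (w t))
      (g (x t) * F (x t) / energyRadius G (x t) (w t)) t := by
  have hpos : 0 < w t ^ 2 + 2 * G (x t) := Real.sqrt_pos.1 (hη.energyRadius_pos hbox (.inl hx₀))
  have henergy : HasDerivAt (fun t => w t ^ 2 + 2 * G (x t)) (2 * (g (x t) * F (x t))) t :=
    (((h.hasDerivAt_snd t hbox).pow 2).add (((hη.hasDerivAt_potential _ hbox).comp t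
      (h.hasDerivAt_fst t hbox)).const_mul 2)).congr_deriv (by ring)
  exact (henergy.sqrt hpos.ne').congr_deriv (mul_div_mul_left _ _ two_ne_zero)

/-- Since `|F| ≤ ρ / 3`, the quantities `ρ + w / 3` and `ρ - w / 3`, which are comparable to `ρ`,
are monotone on the half-plane `0 < x`. -/
theorem energyRadius_le_two_mul (h : IsLienardCurveOn F g η x w) (hη : IsMonodromicOn F g G η)
    (ht : t₀ ≤ t₁) (hbox : ∀ t ∈ Icc t₀ t₁, |x t| ≤ η) (hpos : ∀ t ∈ Ioo t₀ t₁, 0 < x t) :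
    energyRadius G (x t₁) (w t₁) ≤ 2 * energyRadius G (x t₀) (w t₀) ∧
      energyRadius G (x t₀) (w t₀) ≤ 2 * energyRadius G (x t₁) (w t₁) := by
  set ρ : ℝ → ℝ := fun t => energyRadius G (x t) (w t) with hρ
  have hcont : ContinuousOn ρ (Icc t₀ t₁) := h.continuousOn_energyRadius hη hbox
  have hw : ContinuousOn (fun t => w t / 3) (Icc t₀ t₁) :=
    (h.continuous_snd.div_const 3).continuousOn
  have hderiv : ∀ t ∈ Ioo t₀ t₁, ∃ d e, HasDerivAt ρ d t ∧ HasDerivAt (fun t => w t / 3) e t ∧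
      |d| ≤ e := by
    intro t ht
    have hbt := hbox t (Ioo_subset_Icc_self ht)
    have hg := hη.force_pos (hpos t ht) (abs_le.1 hbt).2
    refine ⟨_, _, h.hasDerivAt_energyRadius hη hbt (hpos t ht).ne',
      (h.hasDerivAt_snd t hbt).div_const 3, ?_⟩
    have hr : 0 < ρ t := hη.energyRadius_pos hbt (.inl (hpos t ht).ne')
    rw [abs_div, abs_mul, abs_of_pos hg, abs_of_pos hr, div_le_div_iff₀ hr three_pos, mul_assoc,
      mul_comm _ (3 : ℝ)]
    exact mul_le_mul_of_nonneg_left (hη.three_mul_abs_damping_le hbt (w t)) hg.le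
  choose! d e hd he hde using hderiv
  have hmem₀ := left_mem_Icc.2 ht
  have hmem₁ := right_mem_Icc.2 ht
  have hsub := antitoneOn_of_hasDerivWithinAt_nonpos (convex_Icc t₀ t₁) (hcont.sub hw)
    (f' := fun t => d t - e t)
    (by simpa only [interior_Icc] using fun t ht => ((hd t ht).sub (he t ht)).hasDerivWithinAt)
    (by simpa only [interior_Icc] using fun t ht => by linarith [(abs_le.1 (hde t ht)).2])
    hmem₀ hmem₁ ht
  have hadd := monotoneOn_of_hasDerivWithinAt_nonneg (convex_Icc t₀ t₁) (hcont.add hw)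
    (f' := fun t => d t + e t)
    (by simpa only [interior_Icc] using fun t ht => ((hd t ht).add (he t ht)).hasDerivWithinAt)
    (by simpa only [interior_Icc] using fun t ht => by linarith [(abs_le.1 (hde t ht)).1])
    hmem₀ hmem₁ ht
  have hw₀ := abs_le.1 (hη.abs_le_energyRadius (hbox t₀ hmem₀) (w t₀))
  have hw₁ := abs_le.1 (hη.abs_le_energyRadius (hbox t₁ hmem₁) (w t₁))
  simp only [Pi.sub_apply, Pi.add_apply, hρ] at hsub hadd ⊢
  constructor <;> linarith

end IsLienardCurveOn

/-! ### Turns around the origin -/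

theorem IsMonodromicOn.half_sq_energyRadius_le {F g G : ℝ → ℝ} {η x : ℝ}
    (h : IsMonodromicOn F g G η) (hx : 0 < x) (hxη : x ≤ η) (w : ℝ) :
    energyRadius G x w ^ 2 / 2 ≤ -(F x - w) * w + (3 * η - x) * g x := by
  have hbox : |x| ≤ η := abs_le.2 ⟨by linarith [h.pos], hxη⟩
  have hg : 2 * (x * g x) ≤ (3 * η - x) * g x := by nlinarith [h.force_pos hx hxη]
  rw [h.energyRadius_sq hbox]
  nlinarith [h.damping_sq_le x hbox, h.potential_le x hbox, sq_nonneg (F x - w),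
    h.potential_nonneg hbox]

namespace IsLienardCurveOn

variable {F g G x w : ℝ → ℝ} {η t₀ : ℝ}

/-- The function `(3 * η - x) * w` is bounded by a multiple of the energy radius, while its
derivative is bounded below on the half-plane `0 < x`. -/
theorem exists_notMem_Ioo (h : IsLienardCurveOn F g η x w) (hη : IsMonodromicOn F g G η)
    (hbox : |x t₀| ≤ η) (hr : 0 < energyRadius G (x t₀) (w t₀)) : ∃ t > t₀, x t ∉ Ioo 0 η := by
  by_contra! hstay
  have hbox' : ∀ t ≥ t₀, |x t| ≤ η := fun t ht => by
    rcases ht.eq_or_lt with rfl | hlt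
    · exact hbox
    · exact abs_le.2 ⟨by linarith [(hstay t hlt).1, hη.pos], (hstay t hlt).2.le⟩
  have hradius : ∀ t ≥ t₀, _ := fun t ht =>
    h.energyRadius_le_two_mul hη ht (fun s hs => hbox' s hs.1) fun s hs => (hstay s hs.1).1
  set r := energyRadius G (x t₀) (w t₀)
  set T := t₀ + 200 * η / r with hT
  have htT : t₀ < T := lt_add_of_pos_right _ (by have := hη.pos; positivity)
  have hderiv : ∀ t ≥ t₀, HasDerivAt (fun t => (3 * η - x t) * w t)
      (-(F (x t) - w t) * w t + (3 * η - x t) * g (x t)) t := fun t ht =>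
    ((h.hasDerivAt_fst t (hbox' t ht)).const_sub _).mul (h.hasDerivAt_snd t (hbox' t ht))
  have hbound : ∀ t ≥ t₀, |(3 * η - x t) * w t| ≤ 8 * η * r := fun t ht => by
    rw [abs_mul, show 8 * η * r = (4 * η) * (2 * r) by ring]
    refine mul_le_mul ?_ ((hη.abs_le_energyRadius (hbox' t ht) _).trans (hradius t ht).1)
      (abs_nonneg _) (by linarith [hη.pos])
    exact abs_le.2 (by constructor <;> linarith [abs_le.1 (hbox' t ht), hη.pos])
  have hgrowth : r ^ 2 / 8 * (T - t₀) ≤ (3 * η - x T) * w T - (3 * η - x t₀) * w t₀ := by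
    refine (convex_Icc t₀ T).mul_sub_le_image_sub_of_le_deriv
      (fun t ht => (hderiv t ht.1).continuousAt.continuousWithinAt) ?_ ?_
      _ (left_mem_Icc.2 htT.le) _ (right_mem_Icc.2 htT.le) htT.le
    all_goals
      rw [interior_Icc]
      intro t ht
    · exact (hderiv t ht.1.le).differentiableAt.differentiableWithinAt
    · rw [(hderiv t ht.1.le).deriv]
      obtain ⟨hpos, hlt⟩ := hstay t ht.1
      have hr_le : r ^ 2 ≤ (2 * energyRadius G (x t) (w t)) ^ 2 :=
        pow_le_pow_left₀ hr.le (hradius t ht.1.le).2 2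
      nlinarith [hη.half_sq_energyRadius_le hpos hlt.le (w t)]
  have hlen : r ^ 2 / 8 * (T - t₀) = 25 * η * r := by
    rw [hT]
    field_simp
    ring
  have hT_le := (abs_le.1 (hbound T htT.le)).2
  have ht₀_le := (abs_le.1 (hbound t₀ le_rfl)).1
  nlinarith [mul_pos hη.pos hr]

theorem eventually_fst_mem_Ioo (h : IsLienardCurveOn F g η x w) (hη : IsMonodromicOn F g G η)
    (hlt : |x t₀| < η) (hstart : 0 < x t₀ ∨ x t₀ = 0 ∧ w t₀ < 0) :
    ∀ᶠ t in 𝓝[>] t₀, x t ∈ Ioo 0 η := by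
  have hupper : ∀ᶠ t in 𝓝 t₀, x t < η :=
    h.continuous_fst.continuousAt.eventually_lt_const (abs_lt.1 hlt).2
  refine Eventually.and ?_ (nhdsWithin_le_nhds hupper)
  rcases hstart with hpos | ⟨hx, hw⟩
  · exact nhdsWithin_le_nhds (h.continuous_fst.continuousAt.eventually_const_lt hpos)
  · simpa only [hx] using eventually_lt_nhdsGT_of_hasDerivAt_pos (h.hasDerivAt_fst t₀ hlt.le)
      (by rw [hx, hη.damping_zero]; linarith)

theorem exists_right_arc (h : IsLienardCurveOn F g η x w) (hη : IsMonodromicOn F g G η)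
    (hbox : |x t₀| ≤ η) (hstart : 0 < x t₀ ∨ x t₀ = 0 ∧ w t₀ < 0)
    (hsmall : 2 * energyRadius G (x t₀) (w t₀) < escapeRadius G η) :
    ∃ t₁ > t₀, x t₁ = 0 ∧ 0 < w t₁ ∧ (∀ t ∈ Ioo t₀ t₁, 0 < x t) ∧ (∀ t ∈ Icc t₀ t₁, |x t| ≤ η) ∧
      ∀ t ∈ Icc t₀ t₁, 0 < energyRadius G (x t) (w t) ∧
        energyRadius G (x t) (w t) ≤ 2 * energyRadius G (x t₀) (w t₀) := by
  have hr : 0 < energyRadius G (x t₀) (w t₀) :=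
    hη.energyRadius_pos hbox (hstart.imp ne_of_gt fun h => h.2.ne)
  have hlt : |x t₀| < η := IsMonodromicOn.abs_lt_of_energyRadius_lt hbox (by linarith)
  obtain ⟨s, hs, hsx⟩ := h.exists_notMem_Ioo hη hbox hr
  obtain ⟨t₁, ht, hsub, hexit⟩ :=
    exists_first_exit (isOpen_Ioo.preimage h.continuous_fst)
      (h.eventually_fst_mem_Ioo hη hlt hstart) hs hsx
  have hclosed : ∀ t ∈ Icc t₀ t₁, x t ∈ Icc 0 η := by
    rw [← closure_Ioo ht.ne]
    exact closure_minimal (fun t ht' => Ioo_subset_Icc_self (hsub ht'))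
      (isClosed_Icc.preimage h.continuous_fst)
  have hbox' : ∀ t ∈ Icc t₀ t₁, |x t| ≤ η := fun t ht' =>
    abs_le.2 ⟨by linarith [(hclosed t ht').1, hη.pos], (hclosed t ht').2⟩
  have hradius : ∀ t ∈ Icc t₀ t₁, _ := fun t ht' =>
    h.energyRadius_le_two_mul hη ht'.1 (fun s hs => hbox' s ⟨hs.1, hs.2.trans ht'.2⟩)
      fun s hs => (hsub ⟨hs.1, hs.2.trans_le ht'.2⟩).1
  have hmem := right_mem_Icc.2 ht.le
  have hx₁ : x t₁ = 0 := by
    have hlt₁ := IsMonodromicOn.abs_lt_of_energyRadius_lt (hbox' t₁ hmem)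
      ((hradius t₁ hmem).1.trans_lt hsmall)
    exact le_antisymm (not_lt.1 fun hpos => hexit ⟨hpos, (abs_lt.1 hlt₁).2⟩) (hclosed t₁ hmem).1
  have hw₁ : 0 < w t₁ := by
    have hle := deriv_nonpos_of_pos_left (h.hasDerivAt_fst t₁ (hbox' t₁ hmem)) ht hx₁
      fun t ht' => (hsub ht').1
    have hne : 0 < |w t₁| := by
      rw [← hη.energyRadius_zero_left, ← hx₁]
      linarith [(hradius t₁ hmem).2]
    rw [hx₁, hη.damping_zero] at hle
    exact lt_of_le_of_ne (by linarith) (abs_pos.1 hne).symm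
  exact ⟨t₁, ht, hx₁, hw₁, fun t ht' => (hsub ht').1, hbox', fun t ht' =>
    ⟨by linarith [(hradius t ht').2], (hradius t ht').1⟩⟩

theorem exists_left_arc (h : IsLienardCurveOn F g η x w) (hη : IsMonodromicOn F g G η)
    (hbox : |x t₀| ≤ η) (hstart : x t₀ < 0 ∨ x t₀ = 0 ∧ 0 < w t₀)
    (hsmall : 2 * energyRadius G (x t₀) (w t₀) < escapeRadius G η) :
    ∃ t₁ > t₀, x t₁ = 0 ∧ w t₁ < 0 ∧ (∀ t ∈ Ioo t₀ t₁, x t < 0) ∧ (∀ t ∈ Icc t₀ t₁, |x t| ≤ η) ∧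
      ∀ t ∈ Icc t₀ t₁, 0 < energyRadius G (x t) (w t) ∧
        energyRadius G (x t) (w t) ≤ 2 * energyRadius G (x t₀) (w t₀) := by
  have hturn (t) : energyRadius (fun x => G (-x)) (-x t) (-w t) = energyRadius G (x t) (w t) := by
    simp [energyRadius]
  simpa only [hturn, neg_eq_zero, neg_pos, abs_neg] using
    h.halfTurn.exists_right_arc hη.reflect.neg_damping (by rwa [abs_neg])
      (by simpa only [neg_pos, neg_eq_zero, neg_lt_zero] using hstart)
      (by rwa [hturn, escapeRadius_neg])

end IsLienardCurveOn

/-- On `[t₀, t₂]` the function `x` stays in `[-η, η]`, vanishes at `t₀ < t₁ < t₂`, is positive on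
the first gap and negative on the second: one turn of a Liénard curve around the origin. -/
structure IsTurn (η : ℝ) (x : ℝ → ℝ) (t₀ t₁ t₂ : ℝ) : Prop where
  lt_mid : t₀ < t₁
  mid_lt : t₁ < t₂
  left_eq_zero : x t₀ = 0
  mid_eq_zero : x t₁ = 0
  right_eq_zero : x t₂ = 0
  pos : ∀ t ∈ Ioo t₀ t₁, 0 < x t
  neg : ∀ t ∈ Ioo t₁ t₂, x t < 0
  abs_le : ∀ t ∈ Icc t₀ t₂, |x t| ≤ η

theorem IsTurn.reflect {η : ℝ} {x : ℝ → ℝ} {t₀ t₁ t₂ : ℝ} (h : IsTurn η x t₀ t₁ t₂) :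
    IsTurn η (fun t => -x (-t)) (-t₂) (-t₁) (-t₀) where
  lt_mid := neg_lt_neg h.mid_lt
  mid_lt := neg_lt_neg h.lt_mid
  left_eq_zero := by simpa using h.right_eq_zero
  mid_eq_zero := by simpa using h.mid_eq_zero
  right_eq_zero := by simpa using h.left_eq_zero
  pos t ht := neg_pos.2 (h.neg _ ⟨lt_neg.1 ht.2, neg_lt.1 ht.1⟩)
  neg t ht := neg_lt_zero.2 (h.pos _ ⟨lt_neg.1 ht.2, neg_lt.1 ht.1⟩)
  abs_le t ht := by
    simpa using h.abs_le _ ⟨le_neg.1 ht.2, neg_le.1 ht.1⟩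

namespace IsLienardCurveOn

variable {F g G x w : ℝ → ℝ} {η t₀ : ℝ}

theorem exists_turn (h : IsLienardCurveOn F g η x w) (hη : IsMonodromicOn F g G η)
    (hx : x t₀ = 0) (hw : w t₀ < 0)
    (hsmall : 4 * energyRadius G (x t₀) (w t₀) < escapeRadius G η) :
    ∃ t₁ t₂, IsTurn η x t₀ t₁ t₂ ∧ w t₂ < 0 ∧
      ∀ t ∈ Icc t₀ t₂, 0 < energyRadius G (x t) (w t) := by
  have hbox : |x t₀| ≤ η := by simpa [hx] using hη.pos.le
  have hr := hη.energyRadius_pos hbox (.inr hw.ne)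
  obtain ⟨t₁, h₀₁, hx₁, hw₁, hpos, hboxR, hradR⟩ :=
    h.exists_right_arc hη hbox (.inr ⟨hx, hw⟩) (by linarith)
  have hmem := right_mem_Icc.2 h₀₁.le
  obtain ⟨t₂, h₁₂, hx₂, hw₂, hneg, hboxL, hradL⟩ :=
    h.exists_left_arc hη (hboxR t₁ hmem) (.inr ⟨hx₁, hw₁⟩) (by linarith [(hradR t₁ hmem).2])
  refine ⟨t₁, t₂, ⟨h₀₁, h₁₂, hx, hx₁, hx₂, hpos, hneg, fun t ht => ?_⟩, hw₂, fun t ht => ?_⟩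
  all_goals rcases le_total t t₁ with hle | hle
  · exact hboxR t ⟨ht.1, hle⟩
  · exact hboxL t ⟨hle, ht.2⟩
  · exact (hradR t ⟨ht.1, hle⟩).1
  · exact (hradL t ⟨hle, ht.2⟩).1

theorem exists_reach_negative_axis (h : IsLienardCurveOn F g η x w) (hη : IsMonodromicOn F g G η)
    (hbox : |x t₀| ≤ η) (hne : x t₀ ≠ 0 ∨ w t₀ ≠ 0)
    (hsmall : 4 * energyRadius G (x t₀) (w t₀) < escapeRadius G η) :
    ∃ t, x t = 0 ∧ w t < 0 ∧
      energyRadius G (x t) (w t) ≤ 4 * energyRadius G (x t₀) (w t₀) := by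
  have hr := hη.energyRadius_pos hbox hne
  have hleft : ∀ s, |x s| ≤ η → (x s < 0 ∨ x s = 0 ∧ 0 < w s) →
      2 * energyRadius G (x s) (w s) < escapeRadius G η →
      ∃ t, x t = 0 ∧ w t < 0 ∧
        energyRadius G (x t) (w t) ≤ 2 * energyRadius G (x s) (w s) := fun s hs hstart hsm => by
    obtain ⟨t, hst, hx, hw, -, -, hrad⟩ := h.exists_left_arc hη hs hstart hsm
    exact ⟨t, hx, hw, (hrad t (right_mem_Icc.2 hst.le)).2⟩
  have hstart : (0 < x t₀ ∨ x t₀ = 0 ∧ w t₀ < 0) ∨ (x t₀ < 0 ∨ x t₀ = 0 ∧ 0 < w t₀) := by grind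
  rcases hstart with hstart | hstart
  · obtain ⟨s, hs, hx, hw, -, hboxR, hrad⟩ := h.exists_right_arc hη hbox hstart (by linarith)
    have hmem := right_mem_Icc.2 hs.le
    obtain ⟨t, hxt, hwt, hle⟩ := hleft s (hboxR s hmem) (.inr ⟨hx, hw⟩)
      (by linarith [(hrad s hmem).2])
    exact ⟨t, hxt, hwt, by linarith [(hrad s hmem).2]⟩
  · obtain ⟨t, hxt, hwt, hle⟩ := hleft t₀ hbox hstart (by linarith)
    exact ⟨t, hxt, hwt, by linarith⟩

end IsLienardCurveOn

/-! ### Comparison of the two halves of a turn -/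

namespace IsLienardCurveOn

variable {F g G x w : ℝ → ℝ} {η K t₀ t₁ t₂ : ℝ}

theorem strictMonoOn_snd (h : IsLienardCurveOn F g η x w) (hη : IsMonodromicOn F g G η)
    (hturn : IsTurn η x t₀ t₁ t₂) : StrictMonoOn w (Icc t₀ t₁) := by
  refine strictMonoOn_of_deriv_pos (convex_Icc _ _) h.continuous_snd.continuousOn fun t ht => ?_
  rw [interior_Icc] at ht
  have hbox := hturn.abs_le t ⟨ht.1.le, (ht.2.trans hturn.mid_lt).le⟩
  rw [(h.hasDerivAt_snd t hbox).deriv]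
  exact hη.force_pos (hturn.pos t ht) (abs_le.1 hbox).2

theorem strictAntiOn_snd (h : IsLienardCurveOn F g η x w) (hη : IsMonodromicOn F g G η)
    (hturn : IsTurn η x t₀ t₁ t₂) : StrictAntiOn w (Icc t₁ t₂) := by
  refine strictAntiOn_of_deriv_neg (convex_Icc _ _) h.continuous_snd.continuousOn fun t ht => ?_
  rw [interior_Icc] at ht
  have hbox := hturn.abs_le t ⟨(hturn.lt_mid.trans ht.1).le, ht.2.le⟩
  rw [(h.hasDerivAt_snd t hbox).deriv]
  exact hη.force_neg (hturn.neg t ht) (abs_le.1 hbox).1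

/-- As `w` takes the same value at `t` and `τ t`, it cancels from the derivative of the difference
of the potentials. -/
theorem exists_conjugate_time (h : IsLienardCurveOn F g η x w) (hη : IsMonodromicOn F g G η)
    (hturn : IsTurn η x t₀ t₁ t₂) (hle : w t₂ ≤ w t₀) :
    ∃ τ : ℝ → ℝ, (∀ t ∈ Icc t₀ t₁, τ t ∈ Icc t₁ t₂ ∧ w (τ t) = w t) ∧
      (∀ t ∈ Ioo t₀ t₁, τ t ∈ Ioo t₁ t₂) ∧
      ContinuousOn (fun t => G (x t) - G (x (τ t))) (Icc t₀ t₁) ∧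
      ∀ t ∈ Ioo t₀ t₁, HasDerivAt (fun t => G (x t) - G (x (τ t)))
        (g (x t) * (F (x t) - F (x (τ t)))) t := by
  obtain ⟨τ, hcτ, hτ, hτ'⟩ := exists_continuousOn_conjugate hturn.lt_mid hturn.mid_lt
    h.continuous_snd.continuousOn (h.strictMonoOn_snd hη hturn) (h.strictAntiOn_snd hη hturn) hle
  have hboxR : ∀ t ∈ Icc t₀ t₁, |x t| ≤ η := fun t ht =>
    hturn.abs_le t ⟨ht.1, ht.2.trans hturn.mid_lt.le⟩
  have hboxL : ∀ t ∈ Icc t₁ t₂, |x t| ≤ η := fun t ht =>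
    hturn.abs_le t ⟨hturn.lt_mid.le.trans ht.1, ht.2⟩
  have hG : ∀ t, |x t| ≤ η → HasDerivAt (fun t => G (x t)) (g (x t) * (F (x t) - w t)) t :=
    fun t ht => (hη.hasDerivAt_potential _ ht).comp t (h.hasDerivAt_fst t ht)
  refine ⟨τ, hτ, hτ', ?_, fun t ht => ?_⟩
  · refine ContinuousOn.sub
      (fun t ht => (hG t (hboxR t ht)).continuousAt.continuousWithinAt) fun t ht => ?_
    exact (hG _ (hboxL _ (hτ t ht).1)).continuousAt.comp_continuousWithinAt (hcτ t ht)
  · have htI := Ioo_subset_Icc_self ht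
    have hneg := hη.force_neg (hturn.neg _ (hτ' t ht)) (abs_le.1 (hboxL _ (hτ t htI).1)).1
    have hcomp : HasDerivAt (w ∘ τ) (g (x t)) t :=
      (h.hasDerivAt_snd t (hboxR t htI)).congr_of_eventuallyEq <| by
        filter_upwards [Icc_mem_nhds ht.1 ht.2] with s hs using (hτ s hs).2
    have hdτ : HasDerivAt τ (g (x t) / g (x (τ t))) t :=
      hasDerivAt_of_comp (hcτ.continuousAt (Icc_mem_nhds ht.1 ht.2))
        (h.hasDerivAt_snd _ (hboxL _ (hτ t htI).1)) hneg.ne hcomp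
    refine ((hG t (hboxR t htI)).sub ((hG _ (hboxL _ (hτ t htI).1)).comp t hdτ)).congr_deriv ?_
    rw [(hτ t htI).2]
    have hne := hneg.ne
    field_simp
    ring

theorem exists_conjugate_potential_eq (h : IsLienardCurveOn F g η x w)
    (hη : IsMonodromicOn F g G η) (hturn : IsTurn η x t₀ t₁ t₂) (hle : w t₂ ≤ w t₀)
    (hK : ∀ X ∈ Ioc 0 η, ∀ Y ∈ Ico (-η) 0, g X * (F X - F Y) ≤ K * |G X - G Y|) :
    ∃ τ : ℝ → ℝ, (∀ t ∈ Icc t₀ t₁, τ t ∈ Icc t₁ t₂ ∧ w (τ t) = w t ∧ G (x t) = G (x (τ t))) ∧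
      ∀ t ∈ Ioo t₀ t₁, x t ∈ Ioc 0 η ∧ x (τ t) ∈ Ico (-η) 0 ∧
        g (x t) * (F (x t) - F (x (τ t))) = 0 := by
  obtain ⟨τ, hτ, hτ', hcont, hderiv⟩ := h.exists_conjugate_time hη hturn hle
  have hbox : ∀ t ∈ Icc t₁ t₂, |x t| ≤ η := fun t ht =>
    hturn.abs_le t ⟨hturn.lt_mid.le.trans ht.1, ht.2⟩
  have hmem : ∀ t ∈ Ioo t₀ t₁, x t ∈ Ioc 0 η ∧ x (τ t) ∈ Ico (-η) 0 := fun t ht =>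
    ⟨⟨hturn.pos t ht, (abs_le.1 (hturn.abs_le t ⟨ht.1.le, (ht.2.trans hturn.mid_lt).le⟩)).2⟩,
      (abs_le.1 (hbox _ (Ioo_subset_Icc_self (hτ' t ht)))).1, hturn.neg _ (hτ' t ht)⟩
  have hm₀ := left_mem_Icc.2 hturn.lt_mid.le
  have hm₁ := right_mem_Icc.2 hturn.lt_mid.le
  have hmid : τ t₁ = t₁ := (h.strictAntiOn_snd hη hturn).injOn (hτ t₁ hm₁).1
    (left_mem_Icc.2 hturn.mid_lt.le) (hτ t₁ hm₁).2
  have hzero := eq_zero_of_deriv_le_mul_abs hcont hderiv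
    (fun t ht => hK _ (hmem t ht).1 _ (hmem t ht).2)
    (by simpa [hturn.left_eq_zero, hη.potential_zero] using
      hη.potential_nonneg (hbox _ (hτ t₀ hm₀).1))
    (by simp [hmid])
  refine ⟨τ, fun t ht => ⟨(hτ t ht).1, (hτ t ht).2, sub_eq_zero.1 (hzero t ht)⟩, fun t ht =>
    ⟨(hmem t ht).1, (hmem t ht).2, (hderiv t ht).unique ?_⟩⟩
  refine (hasDerivAt_const t (0 : ℝ)).congr_of_eventuallyEq ?_
  filter_upwards [Icc_mem_nhds ht.1 ht.2] with s hs using hzero s hs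

theorem snd_eq_of_snd_le (h : IsLienardCurveOn F g η x w) (hη : IsMonodromicOn F g G η)
    (hturn : IsTurn η x t₀ t₁ t₂) (hle : w t₂ ≤ w t₀)
    (hK : ∀ X ∈ Ioc 0 η, ∀ Y ∈ Ico (-η) 0, g X * (F X - F Y) ≤ K * |G X - G Y|) :
    w t₂ = w t₀ := by
  obtain ⟨τ, hτ, -⟩ := h.exists_conjugate_potential_eq hη hturn hle hK
  have hm₀ := left_mem_Icc.2 hturn.lt_mid.le
  obtain ⟨hmem, hw, hG⟩ := hτ t₀ hm₀
  have hbox := hturn.abs_le _ ⟨hturn.lt_mid.le.trans hmem.1, hmem.2⟩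
  have hx : x (τ t₀) = 0 := by
    by_contra hne
    rw [hturn.left_eq_zero, hη.potential_zero] at hG
    exact (hη.potential_pos hbox hne).ne hG
  have hne : τ t₀ ≠ t₁ := fun heq => by
    rw [heq] at hw
    exact (h.strictMonoOn_snd hη hturn hm₀ (right_mem_Icc.2 hturn.lt_mid.le)
      hturn.lt_mid).ne hw.symm
  have hright : τ t₀ = t₂ := hmem.2.eq_of_not_lt fun hlt =>
    (hturn.neg _ ⟨hmem.1.lt_of_ne' hne, hlt⟩).ne hx
  rwa [hright] at hw

theorem snd_lt_snd (h : IsLienardCurveOn F g η x w) (hη : IsMonodromicOn F g G η)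
    (hturn : IsTurn η x t₀ t₁ t₂)
    (hK : ∀ X ∈ Ioc 0 η, ∀ Y ∈ Ico (-η) 0, g X * (F X - F Y) < K * |G X - G Y|) :
    w t₀ < w t₂ := by
  by_contra! hle
  obtain ⟨τ, hτ, hτ'⟩ := h.exists_conjugate_potential_eq hη hturn hle
    fun X hX Y hY => (hK X hX Y hY).le
  obtain ⟨t, ht⟩ := nonempty_Ioo.2 hturn.lt_mid
  obtain ⟨hX, hY, hzero⟩ := hτ' t ht
  have hlt := hK _ hX _ hY
  rw [hzero, (hτ t (Ioo_subset_Icc_self ht)).2.2, sub_self, abs_zero, mul_zero] at hlt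
  exact hlt.false

end IsLienardCurveOn

/-- A quantitative form of `S` being a function of the potential `G` on `|x| ≤ η`: the increments
of `S` are controlled by those of `G`. The factor `g X` allows `S` to be a nonsmooth function of
`G` at `0`, such as a fractional power. -/
def FactorsThroughPotential (S g G : ℝ → ℝ) (η : ℝ) : Prop :=
  ∃ K, ∀ X Y, |X| ≤ η → |Y| ≤ η → |g X * (S X - S Y)| ≤ K * |G X - G Y|

theorem FactorsThroughPotential.reflect {S g G : ℝ → ℝ} {η : ℝ}
    (h : FactorsThroughPotential S g G η) :
    FactorsThroughPotential (fun x => S (-x)) (fun x => -g (-x)) (fun x => G (-x)) η := by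
  obtain ⟨K, hK⟩ := h
  refine ⟨K, fun X Y hX hY => ?_⟩
  rw [neg_mul, abs_neg]
  exact hK _ _ (by rwa [abs_neg]) (by rwa [abs_neg])

namespace IsLienardCurveOn

variable {F S g G x w : ℝ → ℝ} {η T t₀ t₁ t₂ : ℝ}

theorem snd_eq_of_factorsThroughPotential (h : IsLienardCurveOn F g η x w)
    (hη : IsMonodromicOn F g G η) (hF : FactorsThroughPotential F g G η)
    (hturn : IsTurn η x t₀ t₁ t₂) : w t₂ = w t₀ := by
  have hone_sided : ∀ {F g G : ℝ → ℝ}, FactorsThroughPotential F g G η →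
      ∃ K, ∀ X ∈ Ioc 0 η, ∀ Y ∈ Ico (-η) 0, g X * (F X - F Y) ≤ K * |G X - G Y| := by
    rintro F g G ⟨K, hK⟩
    refine ⟨K, fun X hX Y hY => (le_abs_self _).trans (hK X Y ?_ ?_)⟩
    · exact abs_le.2 ⟨by linarith [hX.1, hX.2], hX.2⟩
    · exact abs_le.2 ⟨hY.1, by linarith [hY.1, hY.2]⟩
  rcases le_total (w t₂) (w t₀) with hle | hle
  · obtain ⟨K, hK⟩ := hone_sided hF
    exact h.snd_eq_of_snd_le hη hturn hle hK
  · obtain ⟨K, hK⟩ := hone_sided hF.reflect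
    simpa using (h.reflect.snd_eq_of_snd_le hη.reflect hturn.reflect (by simpa using hle) hK).symm

theorem snd_lt_snd_of_factorsThroughPotential (h : IsLienardCurveOn F g η x w)
    (hη : IsMonodromicOn F g G η) (hS : FactorsThroughPotential S g G η)
    (hFS : ∀ x, |x| ≤ η → x ≠ 0 → x * (F x - S x) < 0) (hturn : IsTurn η x t₀ t₁ t₂) :
    w t₀ < w t₂ := by
  obtain ⟨K, hK⟩ := hS
  refine h.snd_lt_snd (K := K) hη hturn fun X hX Y hY => ?_
  have hX' : |X| ≤ η := abs_le.2 ⟨by linarith [hX.1, hX.2], hX.2⟩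
  have hY' : |Y| ≤ η := abs_le.2 ⟨hY.1, by linarith [hY.1, hY.2]⟩
  have hle := (le_abs_self _).trans (hK X Y hX' hY')
  have hRX : F X - S X < 0 := neg_of_mul_neg_right (hFS X hX' hX.1.ne') hX.1.le
  have hRY : 0 < F Y - S Y := pos_of_mul_neg_right (hFS Y hY' hY.2.ne) hY.2.le
  nlinarith [hη.force_pos hX.1 hX.2]

/-- The crossings of the negative `w`-axis strictly increase, so a periodic curve has no highest
one. -/
theorem not_periodic (h : IsLienardCurveOn F g η x w) (hη : IsMonodromicOn F g G η)
    (hS : FactorsThroughPotential S g G η) (hFS : ∀ x, |x| ≤ η → x ≠ 0 → x * (F x - S x) < 0)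
    (hne : ∀ t, x t ≠ 0 ∨ w t ≠ 0) (hx₀ : x t₀ = 0) (hw₀ : w t₀ < 0)
    (hsmall : 4 * |w t₀| < escapeRadius G η) (hT : 0 < T) (hpx : Function.Periodic x T) :
    ¬ Function.Periodic w T := by
  intro hpw
  have hclosed : IsClosed {t | x t = 0 ∧ w t ∈ Icc (w t₀) 0} :=
    (isClosed_eq h.continuous_fst continuous_const).inter
      (isClosed_Icc.preimage h.continuous_snd)
  have hcompact : IsCompact (Icc t₀ (t₀ + T) ∩ {t | x t = 0 ∧ w t ∈ Icc (w t₀) 0}) :=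
    isCompact_Icc.inter_right hclosed
  obtain ⟨s, ⟨-, hxs, hws⟩, hmax⟩ := hcompact.exists_isMaxOn
    ⟨t₀, left_mem_Icc.2 (by linarith), hx₀, le_rfl, hw₀.le⟩ h.continuous_snd.continuousOn
  have hws' : w s < 0 := hws.2.lt_of_ne ((hne s).resolve_left (not_not.2 hxs))
  obtain ⟨t₁, t₂, hturn, hw₂, -⟩ := h.exists_turn hη hxs hws' (by
    rw [hxs, hη.energyRadius_zero_left]
    rw [abs_of_neg hw₀] at hsmall
    rw [abs_of_neg hws']
    linarith [hws.1])
  have hlt := h.snd_lt_snd_of_factorsThroughPotential hη hS hFS hturn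
  obtain ⟨u, hu, hxu, hwu⟩ : ∃ u ∈ Ico t₀ (t₀ + T), x t₂ = x u ∧ w t₂ = w u := by
    obtain ⟨n, hn, -⟩ := existsUnique_sub_zsmul_mem_Ico hT t₂ t₀
    exact ⟨_, hn, (hpx.sub_zsmul_eq n).symm, (hpw.sub_zsmul_eq n).symm⟩
  rw [hwu] at hlt hw₂
  exact hlt.not_ge (hmax ⟨Ico_subset_Icc_self hu, hxu ▸ hturn.right_eq_zero,
    hws.1.trans hlt.le, hw₂.le⟩)

end IsLienardCurveOn

/-! ### Centers of Liénard systems -/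

section Truncation

variable {F g : ℝ → ℝ} {η : ℝ}

theorem exists_lipschitzWith_eq_of_contDiff (hF : ContDiff ℝ 1 F) (hη : 0 < η) :
    ∃ (K : ℝ≥0) (F' : ℝ → ℝ), LipschitzWith K F' ∧ ContDiff ℝ 1 F' ∧
      ∀ x, |x| ≤ η → F' x = F x := by
  let χ : ContDiffBump (0 : ℝ) := ⟨η, 2 * η, hη, by linarith⟩
  have hχ : ContDiff ℝ 1 fun x => χ x * F x := χ.contDiff.mul hF
  obtain ⟨K, hK⟩ := hχ.lipschitzWith_of_hasCompactSupport χ.hasCompactSupport.mul_right one_ne_zero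
  refine ⟨K, _, hK, hχ, fun x hx => ?_⟩
  rw [Pi.mul_apply, χ.one_of_mem_closedBall (by simpa [χ] using hx), one_mul]

theorem exists_isLienardCurveOn (hF : ContDiff ℝ 1 F) (hg : ContDiff ℝ 1 g) (hη : 0 < η)
    (x₀ w₀ : ℝ) :
    ∃ x w : ℝ → ℝ, x 0 = x₀ ∧ w 0 = w₀ ∧ IsLienardCurveOn F g η x w ∧
      ∀ s t, x s = x t → w s = w t →
        Function.Periodic x (s - t) ∧ Function.Periodic w (s - t) := by
  obtain ⟨A, F', hA, hF', hFF'⟩ := exists_lipschitzWith_eq_of_contDiff hF hη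
  obtain ⟨B, g', hB, hg', hgg'⟩ := exists_lipschitzWith_eq_of_contDiff hg hη
  set V : ℝ × ℝ → ℝ × ℝ := fun z => (F' z.1 - z.2, g' z.1)
  have hV := ((hA.comp LipschitzWith.prod_fst).sub LipschitzWith.prod_snd).prodMk
    (hB.comp LipschitzWith.prod_fst)
  have hV₁ : ContDiff ℝ 1 V :=
    ((hF'.comp contDiff_fst).sub contDiff_snd).prodMk (hg'.comp contDiff_fst)
  obtain ⟨z, hz₀, hz⟩ := exists_complete_solution_of_lipschitzWith hV hV₁ (x₀, w₀)
  have hx : ∀ t, HasDerivAt (fun t => (z t).1) (F' (z t).1 - (z t).2) t := fun t => (hz t).fst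
  have hw : ∀ t, HasDerivAt (fun t => (z t).2) (g' (z t).1) t := fun t => (hz t).snd
  have hcont : Continuous z := continuous_iff_continuousAt.2 fun t => (hz t).continuousAt
  refine ⟨fun t => (z t).1, fun t => (z t).2, by simp only [hz₀], by simp only [hz₀],
    ⟨hcont.fst, hcont.snd, fun t ht => ?_, fun t ht => ?_⟩, fun s t hx₁ hw₁ => ?_⟩
  · exact (hx t).congr_deriv (by rw [hFF' _ ht])
  · exact (hw t).congr_deriv (hgg' _ ht)
  · have hper : (fun u => z (u + (s - t))) = z :=
      ODE_solution_unique_univ (v := fun _ => V) (s := fun _ => univ) (t₀ := t)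
        (fun _ => hV.lipschitzOnWith)
        (fun u => ⟨(hz (u + (s - t))).comp_add_const u _, trivial⟩)
        (fun u => ⟨hz u, trivial⟩) (by rw [add_sub_cancel]; exact Prod.ext hx₁ hw₁)
    exact ⟨fun u => congrArg Prod.fst (congrFun hper u),
      fun u => congrArg Prod.snd (congrFun hper u)⟩

end Truncation

theorem exists_periodic_isLienardCurveOn {F g G : ℝ → ℝ} {η x₀ w₀ : ℝ}
    (hη : IsMonodromicOn F g G η) (hF : ContDiff ℝ 1 F) (hg : ContDiff ℝ 1 g)
    (hFG : FactorsThroughPotential F g G η) (hbox : |x₀| ≤ η) (hne : x₀ ≠ 0 ∨ w₀ ≠ 0)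
    (hsmall : 16 * energyRadius G x₀ w₀ < escapeRadius G η) :
    ∃ (x w : ℝ → ℝ) (T : ℝ), x 0 = x₀ ∧ w 0 = w₀ ∧ IsLienardCurveOn F g η x w ∧ 0 < T ∧
      Function.Periodic x T ∧ Function.Periodic w T ∧ (∃ s t, x s ≠ x t) ∧
      ∀ t, |x t| ≤ η ∧ 0 < energyRadius G (x t) (w t) := by
  obtain ⟨x, w, rfl, rfl, hcurve, hclose⟩ := exists_isLienardCurveOn hF hg hη.pos x₀ w₀
  obtain ⟨t₀, hx, hw, hle⟩ := hcurve.exists_reach_negative_axis hη hbox hne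
    (by linarith [hη.energyRadius_pos hbox hne])
  obtain ⟨t₁, t₂, hturn, -, hpos⟩ := hcurve.exists_turn hη hx hw (by linarith)
  obtain ⟨hpx, hpw⟩ := hclose t₂ t₀ (hturn.right_eq_zero.trans hx.symm)
    (hcurve.snd_eq_of_factorsThroughPotential hη hFG hturn)
  have hT : 0 < t₂ - t₀ := sub_pos.2 (hturn.lt_mid.trans hturn.mid_lt)
  obtain ⟨s, hs⟩ := nonempty_Ioo.2 hturn.lt_mid
  refine ⟨x, w, t₂ - t₀, rfl, rfl, hcurve, hT, hpx, hpw, ⟨s, t₀, ?_⟩, fun t => ?_⟩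
  · rw [hx]
    exact (hturn.pos s hs).ne'
  · obtain ⟨n, hn, -⟩ := existsUnique_sub_zsmul_mem_Ico hT t t₀
    rw [add_sub_cancel] at hn
    rw [← hpx.sub_zsmul_eq n, ← hpw.sub_zsmul_eq n]
    exact ⟨hturn.abs_le _ (Ico_subset_Icc_self hn), hpos _ (Ico_subset_Icc_self hn)⟩

section Center

theorem isCenter_of_eventually_exists_isPeriodicOrbit {X : ℝ × ℝ → ℝ × ℝ} {p : ℝ × ℝ}
    (hp : X p = 0)
    (h : ∀ᶠ q in 𝓝[≠] p, ∃ γ : ℝ → ℝ × ℝ, γ 0 = q ∧ IsPeriodicOrbit X γ ∧ ∀ t, γ t ≠ p) :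
    IsCenter X p := by
  refine ⟨hp, insert p {q | ∃ γ : ℝ → ℝ × ℝ, γ 0 = q ∧ IsPeriodicOrbit X γ ∧ ∀ t, γ t ≠ p},
    insert_mem_nhds_iff.2 h, ?_⟩
  rintro q ⟨rfl | ⟨γ, rfl, hγ, hne⟩, hq⟩
  · exact absurd rfl hq
  refine ⟨γ, rfl, hγ, fun t =>
    ⟨.inr ⟨fun s => γ (s + t), by simp only [zero_add], ⟨?_, ?_, ?_⟩, fun s => hne _⟩, hne t⟩⟩
  · exact fun s => (hγ.1 (s + t)).comp_add_const s t
  · by_contra! hconst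
    obtain ⟨u, hu⟩ := hγ.2.1
    have hu₀ := (hconst (u - t)).trans (hconst (-t)).symm
    simp only [sub_add_cancel, neg_add_cancel] at hu₀
    exact hu hu₀
  · obtain ⟨T, hT, hper⟩ := hγ.2.2
    exact ⟨T, hT, Function.Periodic.add_const hper t⟩

/-- The planar system `ẋ = -y`, `ẏ = g x + y * f x`. For an antiderivative `F` of `f`, the
substitution `w = y + F x` turns it into the Liénard equations `ẋ = F x - w`, `ẇ = g x`. -/
def lienardSystem (f g : ℝ → ℝ) : ℝ × ℝ → ℝ × ℝ := fun z => (-z.2, g z.1 + z.2 * f z.1)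

variable {f F g G S : ℝ → ℝ} {η : ℝ}

theorem IsSolution.isLienardCurveOn {γ : ℝ → ℝ × ℝ} (h : IsSolution (lienardSystem f g) γ)
    (hF : ∀ x, HasDerivAt F (f x) x) (η : ℝ) :
    IsLienardCurveOn F g η (fun t => (γ t).1) (fun t => (γ t).2 + F (γ t).1) := by
  have hx : ∀ t, HasDerivAt (fun t => (γ t).1) (-(γ t).2) t := fun t => (h t).fst
  have hy : ∀ t, HasDerivAt (fun t => (γ t).2) (g (γ t).1 + (γ t).2 * f (γ t).1) t := fun t =>
    (h t).snd
  have hw : ∀ t, HasDerivAt (fun t => (γ t).2 + F (γ t).1) (g (γ t).1) t := fun t =>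
    ((hy t).add ((hF _).comp t (hx t))).congr_deriv (by ring)
  exact ⟨continuous_iff_continuousAt.2 fun t => (hx t).continuousAt,
    continuous_iff_continuousAt.2 fun t => (hw t).continuousAt,
    fun t _ => (hx t).congr_deriv (by ring), fun t _ => hw t⟩

theorem IsLienardCurveOn.isSolution {x w : ℝ → ℝ} (h : IsLienardCurveOn F g η x w)
    (hF : ∀ x, HasDerivAt F (f x) x) (hbox : ∀ t, |x t| ≤ η) :
    IsSolution (lienardSystem f g) fun t => (x t, w t - F (x t)) := fun t =>
  (((h.hasDerivAt_fst t (hbox t))).prodMk ((h.hasDerivAt_snd t (hbox t)).sub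
    ((hF _).comp t (h.hasDerivAt_fst t (hbox t))))).congr_deriv
    (by simp only [lienardSystem]; ext <;> ring)

theorem exists_isPeriodicOrbit_lienardSystem (hη : IsMonodromicOn F g G η)
    (hF : ∀ x, HasDerivAt F (f x) x) (hF₁ : ContDiff ℝ 1 F) (hg : ContDiff ℝ 1 g)
    (hFG : FactorsThroughPotential F g G η) {q : ℝ × ℝ} (hbox : |q.1| ≤ η) (hq : q ≠ (0, 0))
    (hsmall : 16 * energyRadius G q.1 (q.2 + F q.1) < escapeRadius G η) :
    ∃ γ : ℝ → ℝ × ℝ, γ 0 = q ∧ IsPeriodicOrbit (lienardSystem f g) γ ∧ ∀ t, γ t ≠ (0, 0) := by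
  have hne : q.1 ≠ 0 ∨ q.2 + F q.1 ≠ 0 := by
    by_contra! h
    refine hq (Prod.ext h.1 ?_)
    simpa [h.1, hη.damping_zero] using h.2
  obtain ⟨x, w, T, hx₀, hw₀, hcurve, hT, hpx, hpw, ⟨s, t, hst⟩, hall⟩ :=
    exists_periodic_isLienardCurveOn hη hF₁ hg hFG hbox hne hsmall
  refine ⟨fun t => (x t, w t - F (x t)), ?_, ⟨hcurve.isSolution hF fun t => (hall t).1, ?_,
    T, hT, fun t => by simp only [hpx t, hpw t]⟩, fun t ht => ?_⟩
  · simp only [hx₀, hw₀, add_sub_cancel_right]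
  · by_contra! hconst
    exact hst (congrArg Prod.fst ((hconst s).trans (hconst t).symm))
  · obtain ⟨hx, hw⟩ := Prod.mk.inj ht
    have hpos := (hall t).2
    rw [hx, hη.damping_zero, sub_zero] at hw
    rw [hx, hw, hη.energyRadius_zero_left, abs_zero] at hpos
    exact hpos.false

theorem isCenter_lienardSystem (hη : IsMonodromicOn F g G η)
    (hF : ∀ x, HasDerivAt F (f x) x) (hF₁ : ContDiff ℝ 1 F) (hg : ContDiff ℝ 1 g)
    (hFG : FactorsThroughPotential F g G η) : IsCenter (lienardSystem f g) (0, 0) := by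
  have hG₀ : ContinuousAt G 0 :=
    (hη.hasDerivAt_potential 0 (by simpa using hη.pos.le)).continuousAt
  have hbox : ContinuousAt (fun q : ℝ × ℝ => |q.1|) (0, 0) := by fun_prop
  have hradius : ContinuousAt (fun q : ℝ × ℝ => 16 * energyRadius G q.1 (q.2 + F q.1)) (0, 0) := by
    have : ContinuousAt (fun q : ℝ × ℝ => G q.1) (0, 0) := hG₀.comp_of_eq continuousAt_fst rfl
    have hF' : Continuous F := hF₁.continuous
    unfold energyRadius
    fun_prop
  refine isCenter_of_eventually_exists_isPeriodicOrbit (by simp [lienardSystem, hη.force_zero]) ?_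
  filter_upwards [self_mem_nhdsWithin,
    nhdsWithin_le_nhds (hbox.eventually_lt_const (by simpa using hη.pos)),
    nhdsWithin_le_nhds (hradius.eventually_lt_const (by
      simpa [hη.damping_zero, hη.energyRadius_zero_left] using hη.escapeRadius_pos))]
    with q hq hqη hqr
  exact exists_isPeriodicOrbit_lienardSystem hη hF hF₁ hg hFG hqη.le hq hqr

theorem not_isCenter_lienardSystem (hη : IsMonodromicOn F g G η)
    (hF : ∀ x, HasDerivAt F (f x) x) (hS : FactorsThroughPotential S g G η)
    (hFS : (∀ x, |x| ≤ η → x ≠ 0 → x * (F x - S x) < 0) ∨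
      ∀ x, |x| ≤ η → x ≠ 0 → 0 < x * (F x - S x)) :
    ¬ IsCenter (lienardSystem f g) (0, 0) := by
  rintro ⟨-, U, hU, hcenter⟩
  have haxis : Tendsto (fun ε : ℝ => ((0 : ℝ), -ε)) (𝓝[>] 0) (𝓝 (0, 0)) :=
    tendsto_nhdsWithin_of_tendsto_nhds <| by
      simpa using (continuous_const.prodMk continuous_neg : Continuous fun ε : ℝ =>
        ((0 : ℝ), -ε)).tendsto 0
  obtain ⟨ε, hεU, hε, hsmall⟩ := ((haxis.eventually hU).and
    (Ioo_mem_nhdsGT (div_pos hη.escapeRadius_pos four_pos))).exists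
  obtain ⟨γ, hγ₀, ⟨hsol, -, T, hT, hper⟩, hmem⟩ :=
    hcenter (0, -ε) ⟨hεU, by simpa using hε.ne'⟩
  have hcurve := hsol.isLienardCurveOn hF η
  have hne : ∀ t, (γ t).1 ≠ 0 ∨ (γ t).2 + F (γ t).1 ≠ 0 := fun t => by
    by_contra! h
    refine (hmem t).2 (Prod.ext h.1 ?_)
    simpa [h.1, hη.damping_zero] using h.2
  have hx₀ : (γ 0).1 = 0 := by rw [hγ₀]
  have hw₀ : (γ 0).2 + F (γ 0).1 = -ε := by rw [hγ₀, hη.damping_zero, add_zero]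
  have hsmall' : 4 * |-ε| < escapeRadius G η := by
    rw [abs_neg, abs_of_pos hε]
    linarith
  have hpx : Function.Periodic (fun t => (γ t).1) T := hper.comp Prod.fst
  have hpw : Function.Periodic (fun t => (γ t).2 + F (γ t).1) T :=
    hper.comp fun z => z.2 + F z.1
  rcases hFS with hFS | hFS
  · exact hcurve.not_periodic (t₀ := 0) hη hS hFS hne hx₀ (by linarith) (by rwa [hw₀]) hT hpx hpw
  · refine hcurve.reflect.not_periodic (t₀ := 0) hη.reflect hS.reflect (fun x hx hx₀ => ?_)
      (fun t => by simpa using hne (-t)) (by simpa using hx₀) (by simpa [hw₀] using hε)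
      (by rwa [neg_zero, hw₀, escapeRadius_neg]) hT (fun t => ?_) fun t => ?_
    · linarith [hFS (-x) (by rwa [abs_neg]) (neg_ne_zero.2 hx₀)]
    · simp only [neg_add, ← sub_eq_add_neg, hper.sub_eq]
    · simp only [neg_add, ← sub_eq_add_neg, hper.sub_eq]

end Center

theorem hasNilpotentForm_lienardSystem {f g : ℝ → ℝ} (hf : AnalyticAt ℝ f 0)
    (hg : AnalyticAt ℝ g 0) (hf₀ : f 0 = 0) (hg₀ : g 0 = 0) (hg₁ : deriv g 0 = 0) :
    HasNilpotentForm (lienardSystem f g) (0, 0) := by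
  have hfst : AnalyticAt ℝ (Prod.fst : ℝ × ℝ → ℝ) 0 := analyticAt_fst
  have hsnd : AnalyticAt ℝ (Prod.snd : ℝ × ℝ → ℝ) 0 := analyticAt_snd
  have hgfst : HasFDerivAt (fun z : ℝ × ℝ => g z.1) (0 : ℝ × ℝ →L[ℝ] ℝ) 0 :=
    (hg.differentiableAt.hasDerivAt.comp_hasFDerivAt (0 : ℝ × ℝ) hasFDerivAt_fst).congr_fderiv
      (by simp [hg₁])
  have hffst : DifferentiableAt ℝ (fun z : ℝ × ℝ => f z.1) 0 :=
    hf.differentiableAt.comp (0 : ℝ × ℝ) differentiableAt_fst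
  have hderiv : HasFDerivAt (fun z : ℝ × ℝ => -(g z.1 + z.2 * f z.1)) 0 0 :=
    (hgfst.add (hasFDerivAt_snd.mul hffst.hasFDerivAt)).neg.congr_fderiv (by simp [hf₀])
  refine ⟨AffineEquiv.refl ℝ _, -1, 0, fun z => -(g z.1 + z.2 * f z.1), rfl, by norm_num,
    ⟨analyticAt_const, rfl, by simp⟩, ⟨?_, by simp [hg₀], hderiv.fderiv⟩,
    .of_forall fun z => by simp [lienardSystem]⟩
  exact ((hg.comp_of_eq hfst rfl).add (hsnd.mul (hf.comp_of_eq hfst rfl))).neg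

/-! ### The quintic system -/

namespace FactorsThroughPotential

variable {S S' s g G : ℝ → ℝ} {η k M : ℝ}

theorem congr (h : FactorsThroughPotential S g G η) (hS : ∀ x, |x| ≤ η → S' x = S x) :
    FactorsThroughPotential S' g G η := by
  obtain ⟨K, hK⟩ := h
  exact ⟨K, fun X Y hX hY => by simpa only [hS X hX, hS Y hY] using hK X Y hX hY⟩

theorem add (h : FactorsThroughPotential S g G η) (h' : FactorsThroughPotential S' g G η) :
    FactorsThroughPotential (fun x => S x + S' x) g G η := by
  obtain ⟨K, hK⟩ := h
  obtain ⟨K', hK'⟩ := h'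
  refine ⟨K + K', fun X Y hX hY => ?_⟩
  rw [add_sub_add_comm, mul_add, add_mul]
  exact (abs_add_le _ _).trans (add_le_add (hK X Y hX hY) (hK' X Y hX hY))

theorem const_mul (h : FactorsThroughPotential S g G η) (k : ℝ) :
    FactorsThroughPotential (fun x => k * S x) g G η := by
  obtain ⟨K, hK⟩ := h
  refine ⟨|k| * K, fun X Y hX hY => ?_⟩
  rw [← mul_sub, mul_left_comm, abs_mul, mul_assoc]
  exact mul_le_mul_of_nonneg_left (hK X Y hX hY) (abs_nonneg k)

theorem of_potential (hg : ContinuousOn g (Icc (-η) η)) : FactorsThroughPotential G g G η := by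
  obtain ⟨M, hM⟩ := isCompact_Icc.exists_bound_of_continuousOn hg
  refine ⟨M, fun X Y hX _ => ?_⟩
  rw [abs_mul]
  exact mul_le_mul_of_nonneg_right (hM X (abs_le.1 hX)) (abs_nonneg _)

theorem sq_of_pow_three (hs : ∀ x, |x| ≤ η → 0 ≤ s x) (hG : ∀ x, |x| ≤ η → s x ^ 3 = k * G x)
    (hg : ∀ x, |x| ≤ η → |g x| ≤ M * s x) (hM : 0 ≤ M) :
    FactorsThroughPotential (fun x => s x ^ 2) g G η := by
  refine ⟨M * |k|, fun X Y hX hY => ?_⟩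
  have hX₀ := hs X hX
  have hY₀ := hs Y hY
  calc |g X * (s X ^ 2 - s Y ^ 2)|
      = |g X| * ((s X + s Y) * |s X - s Y|) := by
        rw [abs_mul, sq_sub_sq, abs_mul, abs_of_nonneg (add_nonneg hX₀ hY₀)]
    _ ≤ M * s X * ((s X + s Y) * |s X - s Y|) := by
        have := hg X hX
        gcongr
    _ = M * ((s X ^ 2 + s X * s Y) * |s X - s Y|) := by ring
    _ ≤ M * ((s X ^ 2 + s X * s Y + s Y ^ 2) * |s X - s Y|) := by
        gcongr ?_ * (?_ * _)
        exact le_add_of_nonneg_right (sq_nonneg _)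
    _ = M * |s X ^ 3 - s Y ^ 3| := by
        rw [← abs_of_nonneg (by positivity : 0 ≤ s X ^ 2 + s X * s Y + s Y ^ 2), ← abs_mul]
        congr 2
        ring
    _ = M * |k| * |G X - G Y| := by rw [hG X hX, hG Y hY, ← mul_sub, abs_mul, mul_assoc]

end FactorsThroughPotential

theorem eventually_nhdsGT_forall_abs_le {p : ℝ → Prop} (h : ∀ᶠ x in 𝓝 (0 : ℝ), p x) :
    ∀ᶠ η in 𝓝[>] (0 : ℝ), ∀ x, |x| ≤ η → p x := by
  obtain ⟨ε, hε, hp⟩ := Metric.eventually_nhds_iff.1 h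
  filter_upwards [Ioo_mem_nhdsGT hε] with η hη x hx
  exact hp (by simpa [Real.dist_eq] using hx.trans_lt hη.2)

section Quintic

/-- The restoring force of `quinticSystem`. -/
def quinticForce (a x : ℝ) : ℝ := x ^ 5 + a * x ^ 6

/-- The coefficient of `y` in `quinticSystem`. -/
def quinticFriction (b c x : ℝ) : ℝ := b * x ^ 3 + c * x ^ 4

/-- The antiderivative of `quinticForce` that vanishes at `0`. -/
noncomputable def quinticPotential (a x : ℝ) : ℝ := x ^ 6 / 6 + a * x ^ 7 / 7

/-- The antiderivative of `quinticFriction` that vanishes at `0`. -/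
noncomputable def quinticDamping (b c x : ℝ) : ℝ := b * x ^ 4 / 4 + c * x ^ 5 / 5

variable {a x : ℝ} (b c : ℝ)

theorem quinticSystem_eq_lienardSystem (a : ℝ) :
    quinticSystem a b c = lienardSystem (quinticFriction b c) (quinticForce a) := rfl

theorem hasDerivAt_quinticPotential (a x : ℝ) :
    HasDerivAt (quinticPotential a) (quinticForce a x) x :=
  (((hasDerivAt_pow 6 x).div_const 6).add
    (((hasDerivAt_pow 7 x).const_mul a).div_const 7)).congr_deriv (by simp [quinticForce]; ring)

theorem hasDerivAt_quinticDamping (x : ℝ) :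
    HasDerivAt (quinticDamping b c) (quinticFriction b c x) x :=
  ((((hasDerivAt_pow 4 x).const_mul b).div_const 4).add
    (((hasDerivAt_pow 5 x).const_mul c).div_const 5)).congr_deriv
    (by simp [quinticFriction]; ring)

theorem contDiff_quinticForce (a : ℝ) : ContDiff ℝ 1 (quinticForce a) := by
  unfold quinticForce
  fun_prop

theorem contDiff_quinticDamping : ContDiff ℝ 1 (quinticDamping b c) := by
  unfold quinticDamping
  fun_prop

theorem eventually_abs_mul_le_half (a : ℝ) : ∀ᶠ x in 𝓝 (0 : ℝ), |a * x| ≤ 1 / 2 := by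
  have hcont : ContinuousAt (fun x : ℝ => |a * x|) 0 := by fun_prop
  exact (hcont.eventually_lt_const (by norm_num)).mono fun _ => le_of_lt

theorem eventually_isMonodromicOn_quintic (a b c : ℝ) : ∀ᶠ η in 𝓝[>] (0 : ℝ),
    IsMonodromicOn (quinticDamping b c) (quinticForce a) (quinticPotential a) η := by
  have hdamping : ∀ᶠ x in 𝓝 (0 : ℝ), (x * (b / 4 + c * x / 5)) ^ 2 < 1 / 64 := by
    have hcont : ContinuousAt (fun x : ℝ => (x * (b / 4 + c * x / 5)) ^ 2) 0 := by fun_prop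
    exact hcont.eventually_lt_const (by norm_num)
  filter_upwards [self_mem_nhdsWithin,
    eventually_nhdsGT_forall_abs_le ((eventually_abs_mul_le_half a).and hdamping)] with η hη hsmall
  refine ⟨hη, by simp [quinticPotential], fun x _ => hasDerivAt_quinticPotential a x,
    fun x hx hx₀ => ?_, fun x hx => ?_, fun x hx => ?_⟩
  all_goals
    obtain ⟨hax, hF⟩ := hsmall x hx
    have hax' := abs_le.1 hax
  · have hpos : 0 < x ^ 6 * (1 + a * x) := mul_pos (by positivity) (by linarith)
    unfold quinticForce
    linarith
  · have hnonneg : 0 ≤ x ^ 6 * (5 / 6 + 6 / 7 * (a * x)) := mul_nonneg (by positivity) (by linarith)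
    unfold quinticPotential quinticForce
    linarith
  · have hle : x ^ 6 * (x * (b / 4 + c * x / 5)) ^ 2 ≤ x ^ 6 * (2 / 9 * (1 / 6 + a * x / 7)) :=
      mul_le_mul_of_nonneg_left (by linarith) (by positivity)
    unfold quinticDamping quinticPotential
    linarith

/-- The root of `m ^ 3 = 1 + 6 / 7 * a * x` that is close to `1` for small `x`. -/
noncomputable def cubeFactor (a x : ℝ) : ℝ := (1 + 6 / 7 * (a * x)) ^ (1 / 3 : ℝ)

theorem cubeFactor_pow_three (h : |a * x| ≤ 1 / 2) : cubeFactor a x ^ 3 = 1 + 6 / 7 * (a * x) := by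
  rw [cubeFactor, ← Real.rpow_natCast, ← Real.rpow_mul (by linarith [abs_le.1 h])]
  norm_num

theorem half_le_cubeFactor (h : |a * x| ≤ 1 / 2) : 1 / 2 ≤ cubeFactor a x := by
  have hbase : 0 ≤ 1 + 6 / 7 * (a * x) := by linarith [abs_le.1 h]
  refine (pow_le_pow_iff_left₀ (by norm_num) (Real.rpow_nonneg hbase _) three_ne_zero).1 ?_
  rw [← cubeFactor, cubeFactor_pow_three h]
  linarith [abs_le.1 h]

theorem cubeFactor_ne_one (h : |a * x| ≤ 1 / 2) (hax : a * x ≠ 0) : cubeFactor a x ≠ 1 := by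
  intro hm
  have hcube := cubeFactor_pow_three h
  rw [hm] at hcube
  exact hax (by linarith)

theorem tendsto_cubeFactor (a : ℝ) : Tendsto (cubeFactor a) (𝓝 0) (𝓝 1) := by
  have hcont : ContinuousAt (cubeFactor a) 0 :=
    ContinuousAt.rpow_const (by fun_prop) (.inl (by norm_num))
  simpa [cubeFactor] using hcont.tendsto

/-- The cube root of six times `quinticPotential`, in the form `x ^ 2 * m`. -/
noncomputable def potentialRoot (a x : ℝ) : ℝ := x ^ 2 * cubeFactor a x

theorem potentialRoot_pow_three (h : |a * x| ≤ 1 / 2) :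
    potentialRoot a x ^ 3 = 6 * quinticPotential a x := by
  rw [potentialRoot, mul_pow, cubeFactor_pow_three h, quinticPotential]
  ring

theorem abs_quinticForce_le (h : |a * x| ≤ 1 / 2) (hx : |x| ≤ 1) :
    |quinticForce a x| ≤ 3 * potentialRoot a x := by
  have hfactor : |1 + a * x| ≤ 3 / 2 := (abs_add_le _ _).trans (by rw [abs_one]; linarith)
  calc |quinticForce a x| = x ^ 2 * (|x| ^ 3 * |1 + a * x|) := by
        rw [quinticForce, show x ^ 5 + a * x ^ 6 = x ^ 2 * (x ^ 3 * (1 + a * x)) by ring, abs_mul,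
          abs_mul, abs_sq, abs_pow]
    _ ≤ x ^ 2 * (1 ^ 3 * (3 / 2)) := by gcongr
    _ ≤ 3 * potentialRoot a x := by
        unfold potentialRoot
        nlinarith [half_le_cubeFactor h, sq_nonneg x]

/-- The part of `quinticDamping` that is a function of the potential `G`, namely the combination
of `G ^ (2 / 3)` and `G` with the same terms in `x ^ 4` and `x ^ 6`. -/
noncomputable def symmetricDamping (a b x : ℝ) : ℝ :=
  b / 4 * potentialRoot a x ^ 2 + 6 / 49 * (a ^ 2 * b) * quinticPotential a x

theorem eventually_factorsThroughPotential_symmetricDamping (a b : ℝ) : ∀ᶠ η in 𝓝[>] (0 : ℝ),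
    FactorsThroughPotential (symmetricDamping a b) (quinticForce a) (quinticPotential a) η := by
  have hone : ∀ᶠ x in 𝓝 (0 : ℝ), |x| ≤ 1 := by
    filter_upwards [Metric.closedBall_mem_nhds (0 : ℝ) one_pos] with x hx
    simpa using hx
  filter_upwards
    [eventually_nhdsGT_forall_abs_le ((eventually_abs_mul_le_half a).and hone)] with η hsmall
  refine .add (.const_mul (.sq_of_pow_three (k := 6) (M := 3) (fun x hx => ?_) (fun x hx => ?_)
    (fun x hx => ?_) (by norm_num)) _) (.const_mul (.of_potential ?_) _)
  · exact mul_nonneg (sq_nonneg x) (by linarith [half_le_cubeFactor (hsmall x hx).1])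
  · exact potentialRoot_pow_three (hsmall x hx).1
  · exact abs_quinticForce_le (hsmall x hx).1 (hsmall x hx).2
  · exact (contDiff_quinticForce a).continuous.continuousOn

/-- The weight of `a * b` in `asymmetry`, in terms of `m = cubeFactor a x`. It is the quotient of
`(m ^ 2 - 1) / 4 - (m ^ 3 - 1) / 6 + m ^ 3 * (m ^ 3 - 1) ^ 2 / 36` by `a * x`, simplified so that
its sign is visible. -/
noncomputable def asymmetryWeight (m : ℝ) : ℝ :=
  (m - 1) ^ 2 * (m ^ 6 + 3 * m ^ 5 + 6 * m ^ 4 + 8 * m ^ 3 + 9 * m ^ 2 + 9 * m + 3) /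
    (42 * (1 + m + m ^ 2))

theorem asymmetryWeight_pos {m : ℝ} (hm : 0 < m) (hm₁ : m ≠ 1) : 0 < asymmetryWeight m := by
  have := sub_ne_zero.2 hm₁
  unfold asymmetryWeight
  positivity

theorem tendsto_asymmetryWeight_cubeFactor (a : ℝ) :
    Tendsto (fun x => asymmetryWeight (cubeFactor a x)) (𝓝 0) (𝓝 0) := by
  have hcont : ContinuousAt asymmetryWeight 1 := by
    unfold asymmetryWeight
    fun_prop (disch := norm_num)
  have hlim := hcont.tendsto.comp (tendsto_cubeFactor a)
  rwa [show asymmetryWeight 1 = 0 by simp [asymmetryWeight]] at hlim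

/-- The difference of `quinticDamping` and `symmetricDamping`, divided by `x ^ 5`. -/
noncomputable def asymmetry (a b c x : ℝ) : ℝ :=
  c / 5 - a * b / 7 - a * b * asymmetryWeight (cubeFactor a x)

theorem cube_sub_one_mul_asymmetryWeight {m : ℝ} (hm : 0 < m) :
    7 / 6 * (m ^ 3 - 1) * asymmetryWeight m =
      (m ^ 2 - 1) / 4 - (m ^ 3 - 1) / 6 + m ^ 3 * (m ^ 3 - 1) ^ 2 / 36 := by
  have hden : 1 + m + m ^ 2 ≠ 0 := by positivity
  unfold asymmetryWeight
  field_simp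
  ring

theorem quinticDamping_sub_symmetricDamping (h : |a * x| ≤ 1 / 2) :
    quinticDamping b c x - symmetricDamping a b x = x ^ 5 * asymmetry a b c x := by
  have hax : a * x = 7 / 6 * (cubeFactor a x ^ 3 - 1) := by linarith [cubeFactor_pow_three h]
  have hweight := cube_sub_one_mul_asymmetryWeight (m := cubeFactor a x)
    (by linarith [half_le_cubeFactor h])
  calc quinticDamping b c x - symmetricDamping a b x
      = x ^ 5 * (c / 5 - a * b / 7) + b * x ^ 4 * ((1 - cubeFactor a x ^ 2) / 4 + a * x / 7 -
          (a * x) ^ 2 * (1 + 6 / 7 * (a * x)) / 49) := by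
        unfold quinticDamping symmetricDamping potentialRoot quinticPotential
        ring
    _ = x ^ 5 * (c / 5 - a * b / 7) -
          b * x ^ 4 * (a * x * asymmetryWeight (cubeFactor a x)) := by
        rw [hax]
        linear_combination (b * x ^ 4) * hweight
    _ = x ^ 5 * asymmetry a b c x := by
        unfold asymmetry
        ring

theorem eventually_asymmetry_sign {a b c : ℝ} (h : ¬ (a * b = 0 ∧ c = 0)) :
    (∀ᶠ x in 𝓝[≠] (0 : ℝ), asymmetry a b c x < 0) ∨
      ∀ᶠ x in 𝓝[≠] (0 : ℝ), 0 < asymmetry a b c x := by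
  by_cases hd : c / 5 - a * b / 7 = 0
  · have hab : a * b ≠ 0 := fun hab => h ⟨hab, by linarith⟩
    have hweight : ∀ᶠ x in 𝓝[≠] (0 : ℝ), 0 < asymmetryWeight (cubeFactor a x) := by
      filter_upwards [self_mem_nhdsWithin,
        nhdsWithin_le_nhds (eventually_abs_mul_le_half a)] with x hx₀ hx
      exact asymmetryWeight_pos (by linarith [half_le_cubeFactor hx])
        (cubeFactor_ne_one hx (mul_ne_zero (left_ne_zero_of_mul hab) hx₀))
    simp only [asymmetry, hd, zero_sub, neg_lt_zero, neg_pos]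
    rcases hab.lt_or_gt with hneg | hpos
    · exact .inr (hweight.mono fun x hx => mul_neg_of_neg_of_pos hneg hx)
    · exact .inl (hweight.mono fun x hx => mul_pos hpos hx)
  · have hlim : Tendsto (asymmetry a b c) (𝓝[≠] 0) (𝓝 (c / 5 - a * b / 7)) := by
      have hlim₀ :=
        ((tendsto_asymmetryWeight_cubeFactor a).const_mul (a * b)).const_sub (c / 5 - a * b / 7)
      rw [mul_zero, sub_zero] at hlim₀
      exact tendsto_nhdsWithin_of_tendsto_nhds hlim₀
    exact (Ne.lt_or_gt hd).imp hlim.eventually_lt_const hlim.eventually_const_lt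

theorem not_isCenter_quinticSystem {a b c : ℝ} (h : ¬ (a * b = 0 ∧ c = 0)) :
    ¬ IsCenter (quinticSystem a b c) (0, 0) := by
  have hprod : ∀ x, |a * x| ≤ 1 / 2 → x * (quinticDamping b c x - symmetricDamping a b x) =
      x ^ 6 * asymmetry a b c x := fun x hx => by
    rw [quinticDamping_sub_symmetricDamping b c hx]
    ring
  have hsign : ∃ η, IsMonodromicOn (quinticDamping b c) (quinticForce a) (quinticPotential a) η ∧
      FactorsThroughPotential (symmetricDamping a b) (quinticForce a) (quinticPotential a) η ∧
      ((∀ x, |x| ≤ η → x ≠ 0 → x * (quinticDamping b c x - symmetricDamping a b x) < 0) ∨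
        ∀ x, |x| ≤ η → x ≠ 0 → 0 < x * (quinticDamping b c x - symmetricDamping a b x)) := by
    have hbase := (eventually_isMonodromicOn_quintic a b c).and
      (eventually_factorsThroughPotential_symmetricDamping a b)
    have hhalf := eventually_abs_mul_le_half a
    rcases eventually_asymmetry_sign h with hs | hs
    all_goals
      obtain ⟨η, ⟨hη, hS⟩, hs⟩ := (hbase.and (eventually_nhdsGT_forall_abs_le
        (hhalf.and (eventually_nhdsWithin_iff.1 hs)))).exists
      refine ⟨η, hη, hS, ?_⟩
    · refine .inl fun x hx hx₀ => ?_
      rw [hprod x (hs x hx).1]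
      exact mul_neg_of_pos_of_neg (by positivity) ((hs x hx).2 hx₀)
    · refine .inr fun x hx hx₀ => ?_
      rw [hprod x (hs x hx).1]
      exact mul_pos (by positivity) ((hs x hx).2 hx₀)
  obtain ⟨η, hη, hS, hFS⟩ := hsign
  rw [quinticSystem_eq_lienardSystem]
  exact not_isCenter_lienardSystem hη (hasDerivAt_quinticDamping b c) hS hFS

theorem isCenter_quinticSystem {a b : ℝ} (hab : a * b = 0) :
    IsCenter (quinticSystem a b 0) (0, 0) := by
  obtain ⟨η, ⟨hη, hS⟩, hhalf⟩ := ((eventually_isMonodromicOn_quintic a b 0).and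
    (eventually_factorsThroughPotential_symmetricDamping a b)).and
      (eventually_nhdsGT_forall_abs_le (eventually_abs_mul_le_half a)) |>.exists
  rw [quinticSystem_eq_lienardSystem]
  refine isCenter_lienardSystem hη (hasDerivAt_quinticDamping b 0) (contDiff_quinticDamping b 0)
    (contDiff_quinticForce a) (hS.congr fun x hx => sub_eq_zero.1 ?_)
  simp [quinticDamping_sub_symmetricDamping b 0 (hhalf x hx), asymmetry, hab]

theorem hasNilpotentForm_quinticSystem (a b c : ℝ) :
    HasNilpotentForm (quinticSystem a b c) (0, 0) := by
  have hf : AnalyticAt ℝ (quinticFriction b c) 0 := by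
    unfold quinticFriction
    fun_prop
  have hg : HasDerivAt (quinticForce a) 0 0 :=
    ((hasDerivAt_pow 5 0).add ((hasDerivAt_pow 6 0).const_mul a)).congr_deriv (by simp)
  have hga : AnalyticAt ℝ (quinticForce a) 0 := by
    unfold quinticForce
    fun_prop
  rw [quinticSystem_eq_lienardSystem]
  exact hasNilpotentForm_lienardSystem hf hga (by simp [quinticFriction]) (by simp [quinticForce])
    hg.deriv

end Quintic

end PlanarSystem

theorem mainTheorem7 (a b c : ℝ) :
    PlanarSystem.IsNilpotentCenter (PlanarSystem.quinticSystem a b c) (0, 0) ↔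
      a * b = 0 ∧ c = 0 := by
  constructor
  · exact fun h => not_not.1 fun hne => PlanarSystem.not_isCenter_quinticSystem hne h.1
  · rintro ⟨hab, rfl⟩
    exact ⟨PlanarSystem.isCenter_quinticSystem hab,
      PlanarSystem.hasNilpotentForm_quinticSystem a b 0⟩
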